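/- **Setting.** For a security parameter $\lambda$, let $\mathcal P_\lambda$ consist of the following primitives. * A non-interactive commitment scheme $(\mathsf{Com},\mathsf{Dec})$ for bit strings: whenever $(com,dec)\leftarrow\mathsf{Com}(msg)$, $\mathsf{Dec}(com,dec,msg)=1$. * A trapdoor function family: coins $r\in\{0,1\}^\lambda$ determine a key and a trapdoor $(k,t_k)=\mathsf{Gen}(r)$; each key has a function $f_k:\{0,1\}^a\to\{0,1\}^b$ and a predicate $h_k:\{0,1\}^a\to\{0,1\}$; $\mathsf{Inv}(t_k,y)$ is a pair of inputs. With probability at least $1-\varepsilon_F(\lambda)$ over uniform coins $r$ and uniform $x$, $f_k(x)$ has exactly two preimages and $\mathsf{Inv}(t_k,f_k(x))$ consists of these two. * Interactive arguments $\Pi^\star$, $\Pi$, $\Pi'$ with completeness errors $\varepsilon_{\rm open}(\lambda)$, $\varepsilon_{\rm key}(\lambda)$, $0$ respectively. $\Pi^\star$ is for the relation $\mathsf{Dec}(com,dec,msg)=1$ (statement $com$, witness $(dec,msg)$). $\Pi$ has statement $(k,r^B,com)$ and witness $(r^A,dec)$: $dec$ opens $com$ to $r^A$ and $k$ is the key generated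 from the coins $r^A\oplus r^B$. $\Pi'$ has statement $(\delta,s^Z,s^X,com)$ and witness $(r,\theta,\phi',dec)$: $\delta=\phi'+\theta+r\pi$ and $\phi'=(-1)^{s^X}\phi+s^Z\pi$ for an angle $\phi$ to which $dec$ opens $com$. No security property (hiding, binding, one-wayness, soundness, zero knowledge) and no efficiency is assumed. **Resource and encoded function.** Let $n\ge 0$, $m\ge 1$, and let $G$ be the $n\times m$ graph of the cluster state or of the brickwork state. Both have the horizontal edges $(i,j)-(i,j+1)$. The vertical edges $(i,j)-(i+1,j)$ are all present in the cluster graph; in the brickwork graph they are present exactly if $i$ is odd and $j\equiv 3,5 \pmod 8$, or $i$ is even, $j\equiv 7,1\pmod 8$ and $j\ne 1$. Alice's input is a family of angles $\Phi=(\phi_{i,j})$, $\phi_{i,j}\in\{0,\frac\pi4,\dots,\frac{7\pi}4\}$. It represents the $n$-qubit unitary $U_\Phi=L_m\cdots L_1$, where $L_j$ applies controlled-$Z$ along the vertical edges of column $j$ and then $H R_z(-\phi_{i,j})$ to qubit $i$, for every $i$, with $R_z(\alpha)=\mathrm{diag}(1,e^{i\alpha})$. For an $n$-qubit pure state $|\psi\rangle$,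 the output $f(|\psi\rangle)\in\{0,1\}^n$ is the random outcome of measuring $U_\Phi|\psi\rangle$ in the computational basis. **Honest run of $\pi_{\mathsf{Q2PC}}$.** Write $|{\pm_\alpha}\rangle=(|0\rangle\pm e^{i\alpha}|1\rangle)/\sqrt2$. 1. For all $i,j$, Alice draws uniform $r^A_{i,j}\in\{0,1\}^\lambda$ and $r_{i,j}\in\{0,1\}$, sends commitments to $r^A_{i,j}$ and to $\phi_{i,j}$, and proves with $\Pi^\star$ that she can open the latter. Bob sends uniform $r^B_{i,j}\in\{0,1\}^\lambda$. Alice computes $(k_{i,j},t_{i,j})=\mathsf{Gen}(r^A_{i,j}\oplus r^B_{i,j})$, sends the keys, and proves their correctness with $\Pi$. 2. For every $i$ and every $j\ge2$ the parties run 8-states QFactory with $k_{i,j}$, that is, two runs of 4-states QFactory whose output qubits are then merged. * *4-states QFactory with key $k$.* Bob prepares $|0\rangle|{+\cdots+}\rangle|0\cdots0\rangle$, applies $U_{f_k}$ from the second register to the third, measures the third (outcome $y$), applies $U_{h_k}$ from the second to the first, measures the second in the Hadamard basis (outcome $b$), and applies $HR_z(-\pi/2)$ to the first. Alice computes $(x,x')=\mathsf{Inv}(t_k,y)$,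 $\theta_2=h_k(x)\oplus h_k(x')$, $\theta_1=\theta_2\langle b,x\oplus x'\rangle\oplus h_k(x)h_k(x')$. * *Merging* of a first output, with bits $\theta_1,\theta_2$, and a second, with bits $\theta_1',\theta_2'$. Bob applies $H$ to the first qubit and controlled-$Z$ to both, and measures the first in the basis $\cos\frac\pi8|0\rangle+\sin\frac\pi8|1\rangle$, $-\sin\frac\pi8|0\rangle+\cos\frac\pi8|1\rangle$, with outcome $s$. The remaining qubit is the result, and Alice's angle for it is $\theta_1'\pi+\theta_2'\frac\pi2+\theta_1\pi$ if $\theta_2=0$, and $\theta_1'\pi+\theta_2'\frac\pi2+(-1)^{\theta_1}\frac\pi4+s\pi$ if $\theta_2=1$. So Alice gets $\theta_{i,j}$ and Bob a qubit, ideally $|{+_{\theta_{i,j}}}\rangle$. The first column consists of the qubits of Bob's input $|\psi\rangle$, for which nothing is prepared remotely and $\theta_{i,1}=0$. Bob applies controlled-$Z$ along all edges of $G$. 3. Column by column, and row by row in each column, Alice sends $\delta_{i,j}=\phi'_{i,j}+\theta_{i,j}+r_{i,j}\pi$ with $\phi'_{i,j}=(-1)^{s^X_{i,j}}\phi_{i,j}+s^Z_{i,j}\pi$,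 and proves it correct with $\Pi'$. Bob measures qubit $(i,j)$ in the basis $|{\pm_{\delta_{i,j}}}\rangle$ and sends the outcome $s'_{i,j}$. Alice sets $\bar s_{i,j}=s'_{i,j}\oplus r_{i,j}$. Here $s^X_v$ and $s^Z_v$ are the parities of the earlier $\bar s_u$ over the $u$ with $g(u)=v$, respectively over the $u\ne v$ for which $g(u)$ is a neighbour of $v$, where $g(i,j)=(i,j+1)$ is the flow. If a proof is rejected, Bob aborts and the output is $\bot$. Otherwise Alice outputs $(\bar s_{i,m})_i$. Let $\mathrm{Out}_\lambda(\Phi,\psi)$ be the distribution of this output. **Theorem (correctness).** In an honest run Alice obtains $f(|\psi\rangle)$. Precisely: 1. For all $\lambda,n,m,\Phi,|\psi\rangle$ and both resources, the total variation distance between $\mathrm{Out}_\lambda(\Phi,\psi)$ and the distribution of $f(|\psi\rangle)$ is at most $nm\,(2\varepsilon_F(\lambda)+\varepsilon_{\rm open}(\lambda)+\varepsilon_{\rm key}(\lambda))$. 2. If $\varepsilon_F(\lambda)=\varepsilon_{\rm open}(\lambda)=\varepsilon_{\rm key}(\lambda)=0$, the two distributions are equal, for all $n,m,\Phi,|\psi\rangle$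 and both resources. 3. If $\varepsilon_F,\varepsilon_{\rm open},\varepsilon_{\rm key}$ are negligible, then for all polynomially bounded $n=n(\lambda)$, $m=m(\lambda)$ and all choices of the resource, $\Phi$ and $|\psi\rangle$ depending on $\lambda$, this distance is negligible in $\lambda$. -/

import Mathlib

open scoped BigOperators

noncomputable section

namespace Q2PC

/-! ## Finite-dimensional pure states, gates and measurements -/

/-- Bit strings of length `k`. -/
abbrev Bits (k : ℕ) : Type := Fin k → Bool

/-- Bitwise exclusive or. -/
def bxor {κ : Type} (x y : κ → Bool) : κ → Bool := fun i => xor (x i) (y i)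

/-- The inner product modulo two of two bit strings. -/
def dotBit {κ : Type} [Fintype κ] (x y : κ → Bool) : Bool :=
  decide (Odd (Finset.univ.filter fun i => x i = true ∧ y i = true).card)

/-- Unit vectors of the Hilbert space whose orthonormal (computational) basis is indexed by `ι`.
A register of qubits labelled by `κ` is the case `ι = (κ → Bool)`. -/
def QState (ι : Type) [Fintype ι] : Type := {v : ι → ℂ // ∑ i, ‖v i‖ ^ 2 = 1}

/-- Unitary operators on that space. -/
abbrev Gate (ι : Type) [Fintype ι] [DecidableEq ι] : Type := Matrix.unitaryGroup ι ℂ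

theorem sum_norm_sq_mulVec {ι : Type} [Fintype ι] [DecidableEq ι] (U : Gate ι) (v : ι → ℂ) :
    ∑ i, ‖(U.1.mulVec v) i‖ ^ 2 = ∑ i, ‖v i‖ ^ 2 := by
  have key : ∀ w : ι → ℂ, ((∑ i, ‖w i‖ ^ 2 : ℝ) : ℂ) = star w ⬝ᵥ w := by
    intro w
    rw [dotProduct]
    push_cast
    refine Finset.sum_congr rfl fun i _ => ?_
    rw [Pi.star_apply, RCLike.star_def, Complex.conj_mul']
  have hU : star U.1 * U.1 = 1 := Matrix.mem_unitaryGroup_iff'.mp U.2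
  have h : star (U.1.mulVec v) ⬝ᵥ (U.1.mulVec v) = star v ⬝ᵥ v := by
    rw [Matrix.star_mulVec, ← Matrix.dotProduct_mulVec, Matrix.mulVec_mulVec,
      ← Matrix.star_eq_conjTranspose, hU, Matrix.one_mulVec]
  have h2 := (key (U.1.mulVec v)).trans (h.trans (key v).symm)
  exact_mod_cast h2

/-- The action of a gate on a state. -/
def Gate.apply {ι : Type} [Fintype ι] [DecidableEq ι] (U : Gate ι) (ψ : QState ι) : QState ι :=
  ⟨U.1.mulVec ψ.1, (sum_norm_sq_mulVec U ψ.1).trans ψ.2⟩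

/-- The basis state `|i⟩`. -/
def ket {ι : Type} [Fintype ι] [DecidableEq ι] (i : ι) : QState ι :=
  ⟨Pi.single i 1, by
    rw [Finset.sum_eq_single i] <;> simp +contextual⟩

/-- The gate permuting the basis states, `|i⟩ ↦ |σ i⟩`, applied to a state. -/
def permute {ι : Type} [Fintype ι] (σ : Equiv.Perm ι) (ψ : QState ι) : QState ι :=
  ⟨fun i => ψ.1 (σ.symm i),
    (Equiv.sum_comp σ.symm fun i => ‖ψ.1 i‖ ^ 2).trans ψ.2⟩

/-- The product state of two registers. -/
def prodState {ι κ : Type} [Fintype ι] [Fintype κ] (ψ : QState ι) (χ : QState κ) :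
    QState (ι × κ) :=
  ⟨fun p => ψ.1 p.1 * χ.1 p.2, by
    rw [Fintype.sum_prod_type]
    simp only [norm_mul, mul_pow, ← Finset.mul_sum, χ.2, mul_one, ψ.2]⟩

/-- A diagonal gate. -/
def diagGate {ι : Type} [Fintype ι] [DecidableEq ι] (d : ι → ℂ) (hd : ∀ i, ‖d i‖ = 1) : Gate ι :=
  ⟨Matrix.diagonal d, by
    rw [Matrix.mem_unitaryGroup_iff, Matrix.star_eq_conjTranspose, Matrix.diagonal_conjTranspose,
      Matrix.diagonal_mul_diagonal, ← Matrix.diagonal_one]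
    congr 1
    funext i
    rw [Pi.star_apply, RCLike.star_def, Complex.mul_conj', hd i]
    norm_num⟩

/-- The gate acting as `g q` on every qubit `q`. -/
def tensorGate {κ : Type} [Fintype κ] [DecidableEq κ] (g : κ → Gate Bool) : Gate (κ → Bool) :=
  ⟨Matrix.of fun a b => ∏ q, (g q).1 (a q) (b q), by
    rw [Matrix.mem_unitaryGroup_iff]
    ext a b
    have h : ∀ q, ∑ c, (g q).1 (a q) c * star ((g q).1 (b q) c)
        = (1 : Matrix Bool Bool ℂ) (a q) (b q) := by
      intro q
      rw [← Matrix.mem_unitaryGroup_iff.mp (g q).2, Matrix.mul_apply]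
      rfl
    rw [Matrix.mul_apply]
    simp only [Matrix.star_apply, Matrix.of_apply, star_prod, ← Finset.prod_mul_distrib]
    rw [← Fintype.prod_sum fun q c => (g q).1 (a q) c * star ((g q).1 (b q) c)]
    simp only [h, Matrix.one_apply]
    by_cases hab : a = b
    · simp [hab]
    · rw [if_neg hab]
      obtain ⟨q, hq⟩ := Function.ne_iff.mp hab
      exact Finset.prod_eq_zero (Finset.mem_univ q) (if_neg hq)⟩

/-- A single-qubit gate on qubit `q` of a register. -/
def onQubit {κ : Type} [Fintype κ] [DecidableEq κ] (q : κ) (g : Gate Bool) : Gate (κ → Bool) :=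
  tensorGate fun q' => if q' = q then g else 1

/-- A gate on the second of two registers. -/
def onSnd {ι κ : Type} [Fintype ι] [DecidableEq ι] [Fintype κ] [DecidableEq κ] (U : Gate κ) :
    Gate (ι × κ) :=
  ⟨Matrix.kronecker 1 U.1, Matrix.kronecker_mem_unitary (one_mem _) U.2⟩

/-- The Hadamard gate `H`. -/
def hadamard : Gate Bool :=
  ⟨Matrix.of fun a b => (((Real.sqrt 2)⁻¹ : ℝ) : ℂ) * (if a = true ∧ b = true then -1 else 1), by
    have h2 : (((Real.sqrt 2)⁻¹ : ℝ) : ℂ) * (((Real.sqrt 2)⁻¹ : ℝ) : ℂ) = 1 / 2 := by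
      rw [← Complex.ofReal_mul, ← mul_inv, Real.mul_self_sqrt (by norm_num)]
      norm_num
    rw [Matrix.mem_unitaryGroup_iff]
    ext a b
    rw [Matrix.mul_apply]
    simp only [Matrix.star_apply, Matrix.of_apply, Fintype.sum_bool, RCLike.star_def, map_mul,
      Complex.conj_ofReal, Matrix.one_apply]
    generalize (((Real.sqrt 2)⁻¹ : ℝ) : ℂ) = c at h2
    cases a <;> cases b <;> simp <;> linear_combination 2 * h2⟩

/-- The rotation `R_z(α) = diag(1, e^{iα})`. -/
def rotZ (α : ℝ) : Gate Bool :=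
  diagGate (fun b => if b = true then Complex.exp (α * Complex.I) else 1) (by
    intro b
    cases b <;> simp [Complex.norm_exp_ofReal_mul_I])

/-- The rotation with rows `(cos α, sin α)` and `(-sin α, cos α)`. -/
def rotY (α : ℝ) : Gate Bool :=
  ⟨Matrix.of fun a b => if a = b then (Real.cos α : ℂ)
      else if a = true then -(Real.sin α : ℂ) else (Real.sin α : ℂ), by
    have h : (Real.cos α : ℂ) * Real.cos α + (Real.sin α : ℂ) * Real.sin α = 1 := by
      have h0 := Real.cos_sq_add_sin_sq α
      rw [sq, sq] at h0
      exact_mod_cast h0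
    rw [Matrix.mem_unitaryGroup_iff]
    ext a b
    rw [Matrix.mul_apply]
    simp only [Matrix.star_apply, Matrix.of_apply, Fintype.sum_bool, RCLike.star_def,
      Matrix.one_apply]
    generalize Real.cos α = c at h
    generalize Real.sin α = s at h
    cases a <;> cases b <;> simp
    · linear_combination h
    · ring
    · ring
    · linear_combination h⟩

/-- The rescaling of a vector to norm one; the fallback value is used for the zero vector only,
that is, after a measurement outcome of probability zero. -/
def normalize {ι : Type} [Fintype ι] (v : ι → ℂ) (fallback : QState ι) : QState ι :=
  if h : ∑ i, ‖v i‖ ^ 2 = 0 then fallback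
  else ⟨fun i => v i / ((Real.sqrt (∑ k, ‖v k‖ ^ 2) : ℝ) : ℂ), by
    have h0 : 0 ≤ ∑ k, ‖v k‖ ^ 2 := Finset.sum_nonneg fun i _ => by positivity
    simp only [norm_div, div_pow, Complex.norm_real, Real.norm_eq_abs, sq_abs, Real.sq_sqrt h0]
    rw [← Finset.sum_div, div_self h]⟩

/-- Measurement of a whole register in the computational basis (Born rule). -/
def born {ι : Type} [Fintype ι] (ψ : QState ι) : PMF ι :=
  PMF.ofFintype (fun i => ENNReal.ofReal (‖ψ.1 i‖ ^ 2)) (by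
    rw [← ENNReal.ofReal_sum_of_nonneg fun i _ => by positivity, ψ.2, ENNReal.ofReal_one])

/-- Measurement of the second of two registers in the computational basis. The result is the
outcome and the state of the first register after it. -/
def measureSnd {ι κ : Type} [Fintype ι] [DecidableEq ι] [Inhabited ι] [Fintype κ]
    (ψ : QState (ι × κ)) : PMF (κ × QState ι) := do
  let p ← born ψ
  pure (p.2, normalize (fun a => ψ.1 (a, p.2)) (ket default))

/-- Measurement of qubit `q` of a register in the computational basis. The qubit stays in the
register. -/
def measureQubit {κ : Type} [Fintype κ] [DecidableEq κ] (q : κ) (ψ : QState (κ → Bool)) :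
    PMF (Bool × QState (κ → Bool)) := do
  let x ← born ψ
  pure (x q, normalize (fun a => if a q = x q then ψ.1 a else 0) ψ)

/-- Measurement of qubit `q` in the basis `|±_α⟩ = (|0⟩ ± e^{iα}|1⟩) / √2`: outcome `0` is
`|+_α⟩`, outcome `1` is `|-_α⟩`. As `H R_z(-α)` carries this basis to the computational one,
the qubit is rotated by `H R_z(-α)` and then read. -/
def measureXY {κ : Type} [Fintype κ] [DecidableEq κ] (q : κ) (α : ℝ) (ψ : QState (κ → Bool)) :
    PMF (Bool × QState (κ → Bool)) :=
  measureQubit q ((onQubit q (hadamard * rotZ (-α))).apply ψ)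

/-- Total variation distance of two distributions on a finite type. -/
def tvDist {α : Type} [Fintype α] (p q : PMF α) : ℝ :=
  (1 / 2) * ∑ a, |(p a).toReal - (q a).toReal|

/-- Run `p 0, …, p (k - 1)` in this order and collect the results. -/
def forAll {M : Type → Type} [Monad M] {α : Type} : (k : ℕ) → (Fin k → M α) → M (Fin k → α)
  | 0, _ => pure Fin.elim0
  | k + 1, p => do
    let a ← p 0
    let rest ← forAll k fun i => p i.succ
    pure (Fin.cons a rest : Fin (k + 1) → α)

/-- The same for a doubly indexed family. -/
def forGrid {M : Type → Type} [Monad M] {α : Type} {n k : ℕ} (p : Fin n → Fin k → M α) :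
    M (Fin n → Fin k → α) :=
  forAll n fun i => forAll k fun j => p i j

/-! ## Resource states and the function encoded by the angles -/

/-- A multiple of `π / 4`. -/
def angle (a : ZMod 8) : ℝ := (a.val : ℝ) * (Real.pi / 4)

/-- The two families of resource graphs. -/
inductive Resource
  | cluster
  | brickwork

/-- Whether the resource has an edge between the rows with (zero-based) numbers `i` and `i + 1` in
the column with (zero-based) number `j`. The cluster state has all of them. With rows and columns
counted from one, the brickwork state has those with odd row in the columns `c ≡ 3, 5 (mod 8)`, and
those with even row in the columns `c ≡ 7, 1 (mod 8)`, except for `c = 1`. -/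
def Resource.bond : Resource → ℕ → ℕ → Prop
  | .cluster, _, _ => True
  | .brickwork, i, j =>
      (Odd (i + 1) ∧ ((j + 1) % 8 = 3 ∨ (j + 1) % 8 = 5)) ∨
      (Even (i + 1) ∧ ((j + 1) % 8 = 7 ∨ ((j + 1) % 8 = 1 ∧ j ≠ 0)))

/-- Vertices of a grid with `n` rows and `m + 1` columns. Column `0` is the first layer. -/
abbrev Vertex (n m : ℕ) : Type := Fin n × Fin (m + 1)

/-- The graph of the resource state: all horizontal edges, and the vertical ones listed above. -/
def Resource.graph (R : Resource) (n m : ℕ) : SimpleGraph (Vertex n m) :=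
  SimpleGraph.fromRel fun u v =>
    (u.1 = v.1 ∧ u.2.val + 1 = v.2.val) ∨
    (u.2 = v.2 ∧ u.1.val + 1 = v.1.val ∧ R.bond u.1.val u.2.val)

open Classical in
/-- The product of the controlled-`Z` gates along all edges of a graph. -/
def czGate {κ : Type} [Fintype κ] [DecidableEq κ] (G : SimpleGraph κ) : Gate (κ → Bool) :=
  diagGate (fun a => (-1) ^ (G.edgeFinset.filter fun e => ∀ v ∈ e, a v = true).card) (by
    intro a
    simp)

/-- Column `j` of the one-way computation as a circuit on `n` qubits: controlled-`Z` along the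
vertical edges of the column, then `H R_z(-φ_{i,j})` on every qubit `i`. -/
def layerGate (R : Resource) {n m : ℕ} (Φ : Fin n → Fin (m + 1) → ZMod 8) (j : Fin (m + 1)) :
    Gate (Bits n) :=
  tensorGate (fun i => hadamard * rotZ (-angle (Φ i j))) *
    czGate ((R.graph n m).comap fun i => (i, j))

/-- The `n`-qubit unitary that the angles `Φ` represent on the resource: the columns applied one
after the other, column `0` first. -/
def encodedUnitary (R : Resource) {n m : ℕ} (Φ : Fin n → Fin (m + 1) → ZMod 8) : Gate (Bits n) :=
  ((List.finRange (m + 1)).reverse.map (layerGate R Φ)).prod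

/-- The classical outcome `f(|ψ⟩)`: apply the encoded unitary and measure all qubits in the
computational basis. -/
def idealOutput (R : Resource) {n m : ℕ} (Φ : Fin n → Fin (m + 1) → ZMod 8)
    (ψ : QState (Bits n)) : PMF (Bits n) :=
  born ((encodedUnitary R Φ).apply ψ)

/-! ## Dependencies from the flow -/

/-- The flow `(i, j) ↦ (i, j + 1)` of the grid, as a relation. -/
def IsFlow {n m : ℕ} (u v : Vertex n m) : Prop := u.1 = v.1 ∧ u.2.val + 1 = v.2.val

open Classical in
/-- `s^X` at `v`: the parity of the outcomes at the vertices whose flow image is `v`. Vertices that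
have not been measured carry the value `false`. -/
def xDep {n m : ℕ} (s : Vertex n m → Bool) (v : Vertex n m) : Bool :=
  decide (Odd (Finset.univ.filter fun u => s u = true ∧ IsFlow u v).card)

open Classical in
/-- `s^Z` at `v`: the parity of the outcomes at the vertices `u ≠ v` whose flow image is a
neighbour of `v`. -/
def zDep (R : Resource) {n m : ℕ} (s : Vertex n m → Bool) (v : Vertex n m) : Bool :=
  decide (Odd (Finset.univ.filter fun u =>
    s u = true ∧ u ≠ v ∧ ∃ w, IsFlow u w ∧ (R.graph n m).Adj w v).card)

/-- `φ' = (-1)^{s^X} φ + s^Z π`. -/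
def adaptedAngle (φ : ZMod 8) (sX sZ : Bool) : ZMod 8 :=
  (if sX = true then -φ else φ) + (if sZ = true then 4 else 0)

/-! ## Cryptographic primitives

Only the correctness clauses of the primitives are recorded: honest runs do not depend on hiding,
binding, one-wayness, soundness or zero knowledge. -/

/-- A non-interactive commitment scheme for bit strings with its correctness. -/
structure CommitmentScheme where
  Com : Type
  Dec : Type
  commit : List Bool → PMF (Com × Dec)
  verify : Com → Dec → List Bool → Bool
  correct : ∀ msg, ∀ p ∈ (commit msg).support, verify p.1 p.2 msg = true

/-- A pair of classical interactive machines, with statements in `X` and witnesses in `W`. -/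
structure InteractiveArgument (X W : Type) where
  Msg : Type
  ProverState : Type
  VerifierState : Type
  rounds : X → ℕ
  proverInit : X → W → PMF ProverState
  verifierInit : X → PMF (VerifierState × Msg)
  proverStep : ProverState → Msg → PMF (ProverState × Msg)
  verifierStep : VerifierState → Msg → PMF (VerifierState × Msg)
  accept : VerifierState → Bool

/-- `r` rounds of interaction. -/
def InteractiveArgument.interact {X W : Type} (A : InteractiveArgument X W) :
    ℕ → A.ProverState → A.VerifierState → A.Msg → PMF A.VerifierState
  | 0, _, v, _ => pure v
  | r + 1, p, v, c => do
    let pa ← A.proverStep p c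
    let vc ← A.verifierStep v pa.2
    A.interact r pa.1 vc.1 vc.2

/-- The decision `⟨P(w), V⟩(x)` of the verifier. -/
def InteractiveArgument.run {X W : Type} (A : InteractiveArgument X W) (x : X) (w : W) :
    PMF Bool := do
  let p ← A.proverInit x w
  let vc ← A.verifierInit x
  let v ← A.interact (A.rounds x) p vc.1 vc.2
  pure (A.accept v)

/-- Completeness for a relation, up to the error `ε`. -/
def InteractiveArgument.Complete {X W : Type} (A : InteractiveArgument X W) (Rel : X → W → Prop)
    (ε : ℝ) : Prop :=
  ∀ x w, Rel x w → 1 - ε ≤ (A.run x w true).toReal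

/-- A trapdoor function family with a predicate on the inputs. Key generation is deterministic in
its `lam` random coins, and `inv` returns the two preimages of an image. -/
structure TrapdoorFamily (lam : ℕ) where
  Key : Type
  Trapdoor : Type
  inLen : ℕ
  outLen : ℕ
  gen : Bits lam → Key × Trapdoor
  eval : Key → Bits inLen → Bits outLen
  pred : Key → Bits inLen → Bool
  inv : Trapdoor → Bits outLen → Bits inLen × Bits inLen

/-- The image of `x` under the function generated from the coins `r` has exactly two preimages, and
the trapdoor yields them. -/
def TrapdoorFamily.Good {lam : ℕ} (F : TrapdoorFamily lam) (r : Bits lam) (x : Bits F.inLen) :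
    Prop :=
  let y := F.eval (F.gen r).1 x
  let p := F.inv (F.gen r).2 y
  p.1 ≠ p.2 ∧ ∀ z, F.eval (F.gen r).1 z = y ↔ z = p.1 ∨ z = p.2

open Classical in
/-- Two-regularity and inversion hold up to probability `ε` over uniform coins and input. -/
def TrapdoorFamily.TwoRegular {lam : ℕ} (F : TrapdoorFamily lam) (ε : ℝ) : Prop :=
  ((Finset.univ.filter fun p : Bits lam × Bits F.inLen => ¬ F.Good p.1 p.2).card : ℝ) ≤
    ε * Fintype.card (Bits lam × Bits F.inLen)

/-- An angle as a three-bit message. -/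
def encodeAngle (a : ZMod 8) : List Bool := [a.val.testBit 0, a.val.testBit 1, a.val.testBit 2]

/-- The primitives used by the protocol at security parameter `lam`. -/
structure Primitives (lam : ℕ) where
  com : CommitmentScheme
  tdf : TrapdoorFamily lam
  /-- `Π⋆`: knowledge of an opening of a commitment -/
  zkOpen : InteractiveArgument com.Com (com.Dec × List Bool)
  /-- `Π`: correct generation of a key `k`; statements are `(k, r_f^B, com_f)` -/
  zkKey : InteractiveArgument (tdf.Key × Bits lam × com.Com) (Bits lam × com.Dec)
  /-- `Π'`: correct computation of an angle; statements are `(δ, s^Z, s^X, com)`, witnesses are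
  `(r, θ, φ', dec)` -/
  zkAngle : InteractiveArgument (ZMod 8 × Bool × Bool × com.Com)
    (Bool × ZMod 8 × ZMod 8 × com.Dec)

variable {lam : ℕ}

def Primitives.RelOpen (P : Primitives lam) (x : P.com.Com) (w : P.com.Dec × List Bool) : Prop :=
  P.com.verify x w.1 w.2 = true

def Primitives.RelKey (P : Primitives lam) (x : P.tdf.Key × Bits lam × P.com.Com)
    (w : Bits lam × P.com.Dec) : Prop :=
  P.com.verify x.2.2 w.2 (List.ofFn w.1) = true ∧ (P.tdf.gen (bxor w.1 x.2.1)).1 = x.1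

def Primitives.RelAngle (P : Primitives lam) (x : ZMod 8 × Bool × Bool × P.com.Com)
    (w : Bool × ZMod 8 × ZMod 8 × P.com.Dec) : Prop :=
  x.1 = w.2.2.1 + w.2.1 + (if w.1 = true then 4 else 0) ∧
  ∃ φ : ZMod 8, w.2.2.1 = adaptedAngle φ x.2.2.1 x.2.1 ∧
    P.com.verify x.2.2.2 w.2.2.2 (encodeAngle φ) = true

/-- Correctness of the primitives with errors `εF`, `εOpen`, `εKey`. The argument system `Π'` is
perfectly complete. -/
structure Primitives.Correct (P : Primitives lam) (εF εOpen εKey : ℝ) : Prop where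
  twoRegular : P.tdf.TwoRegular εF
  openComplete : P.zkOpen.Complete P.RelOpen εOpen
  keyComplete : P.zkKey.Complete P.RelKey εKey
  angleComplete : P.zkAngle.Complete P.RelAngle 0

/-! ## Remote state preparation (QFactory) -/

/-- `U_g : |a, x⟩ ↦ |a ⊕ g(x), x⟩` with a single-qubit target. -/
def oracleBit {ι : Type} (g : ι → Bool) : Equiv.Perm (Bool × ι) :=
  Function.Involutive.toPerm (fun p => (xor p.1 (g p.2), p.2)) (by
    intro p
    simp)

/-- `U_g : |a, x, y⟩ ↦ |a, x, y ⊕ g(x)⟩`. -/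
def oracleBits {ι : Type} {k : ℕ} (g : ι → Bits k) : Equiv.Perm ((Bool × ι) × Bits k) :=
  Function.Involutive.toPerm (fun p => (p.1, bxor p.2 (g p.1.2))) (by
    rintro ⟨a, y⟩
    refine Prod.ext rfl (funext fun i => ?_)
    change xor (xor (y i) (g a.2 i)) (g a.2 i) = y i
    simp)

/-- Bob's part of 4-states QFactory with key `k`. The registers are the output qubit, the preimage
register and the image register. He prepares `|0⟩|+…+⟩|0…0⟩`, applies `U_f`, reads `y` from the
image register, applies `U_h`, reads `b` from the preimage register in the Hadamard basis, and
applies `H R_z(-π/2)` to the output qubit. The result is `((y, b), output qubit)`. -/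
def bobQFactory4 (F : TrapdoorFamily lam) (k : F.Key) :
    PMF ((Bits F.outLen × Bits F.inLen) × QState Bool) := do
  let start : QState ((Bool × Bits F.inLen) × Bits F.outLen) :=
    prodState ((onSnd (tensorGate fun _ => hadamard)).apply
      (prodState (ket false) (ket fun _ => false))) (ket fun _ => false)
  let my ← measureSnd (permute (oracleBits (F.eval k)) start)
  let mb ← measureSnd ((onSnd (tensorGate fun _ => hadamard)).apply
    (permute (oracleBit (F.pred k)) my.2))
  pure ((my.1, mb.1), (hadamard * rotZ (-(Real.pi / 2))).apply mb.2)

/-- Alice's part of 4-states QFactory: the bits `(θ₁, θ₂)` from Bob's message `(y, b)`. -/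
def aliceQFactory4 (F : TrapdoorFamily lam) (k : F.Key) (t : F.Trapdoor)
    (msg : Bits F.outLen × Bits F.inLen) : Bool × Bool :=
  let p := F.inv t msg.1
  let θ₂ := xor (F.pred k p.1) (F.pred k p.2)
  (xor (θ₂ && dotBit msg.2 (bxor p.1 p.2)) (F.pred k p.1 && F.pred k p.2), θ₂)

/-- The controlled-`Z` gate on two qubits. -/
def czPair : Gate (Bool × Bool) :=
  diagGate (fun p => if p.1 = true ∧ p.2 = true then -1 else 1) (by
    intro p
    split_ifs <;> simp)

/-- Bob's merging of two 4-states outputs `|+_θ⟩` (ancilla) and `|+_θ'⟩` (target) into one qubit: `H`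
on the ancilla, controlled-`Z`, and a measurement of the ancilla in the basis
`cos(π/8)|0⟩ + sin(π/8)|1⟩`, `-sin(π/8)|0⟩ + cos(π/8)|1⟩`. The result is the outcome and the target. -/
def bobMerge (ancilla target : QState Bool) : PMF (Bool × QState Bool) :=
  measureSnd ((onSnd (rotY (Real.pi / 8))).apply
    (czPair.apply ((onSnd hadamard).apply (prodState target ancilla))))

/-- Alice's description of the merged qubit. With the bits `θ` of the ancilla, `θ'` of the target and
the outcome `s`, the angle is `θ₁' π + θ₂' π/2` plus `θ₁ π` if `θ₂ = 0`, or plus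
`(-1)^{θ₁} π/4 + s π` if `θ₂ = 1`. -/
def aliceMerge (θ θ' : Bool × Bool) (s : Bool) : ZMod 8 :=
  (if θ'.1 = true then 4 else 0) + (if θ'.2 = true then 2 else 0) +
    if θ.2 = true then (if θ.1 = true then -1 else 1) + (if s = true then 4 else 0)
    else (if θ.1 = true then 4 else 0)

/-- 8-states QFactory: two runs of 4-states QFactory, then the merging. Alice ends with an angle,
Bob with a qubit. -/
def qfactory8 (F : TrapdoorFamily lam) (k : F.Key) (t : F.Trapdoor) :
    PMF (ZMod 8 × QState Bool) := do
  let a ← bobQFactory4 F k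
  let b ← bobQFactory4 F k
  let c ← bobMerge a.2 b.2
  pure (aliceMerge (aliceQFactory4 F k t a.1) (aliceQFactory4 F k t b.1) c.1, c.2)

/-! ## The protocol -/

/-- Restriction of a labelling of the grid to the first layer and to the other layers. -/
def splitGrid (n m : ℕ) : (Vertex n m → Bool) ≃ Bits n × (Fin n → Fin m → Bool) where
  toFun a := (fun i => a (i, 0), fun i j => a (i, j.succ))
  invFun p := fun v => (Fin.cons (p.1 v.1) (p.2 v.1) : Fin (m + 1) → Bool) v.2
  left_inv a := by
    funext v
    obtain ⟨i, j⟩ := v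
    refine Fin.cases ?_ (fun j => ?_) j <;> simp
  right_inv p := by
    simp

/-- The product state with `ψ` on the first layer and `q i j` at row `i` of layer `j + 1`. -/
def gridState {n m : ℕ} (ψ : QState (Bits n)) (q : Fin n → Fin m → QState Bool) :
    QState (Vertex n m → Bool) :=
  ⟨fun a => ψ.1 (fun i => a (i, 0)) * ∏ i, ∏ j, (q i j).1 (a (i, j.succ)), by
    have h := Equiv.sum_comp (splitGrid n m) (fun p : Bits n × (Fin n → Fin m → Bool) =>
      ‖ψ.1 p.1 * ∏ i, ∏ j, (q i j).1 (p.2 i j)‖ ^ 2)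
    refine h.trans ?_
    rw [Fintype.sum_prod_type]
    simp only [norm_mul, mul_pow, norm_prod, ← Finset.prod_pow, ← Finset.mul_sum]
    have h1 : ∑ y : Fin n → Fin m → Bool, ∏ i, ∏ j, ‖(q i j).1 (y i j)‖ ^ 2 = 1 := by
      rw [← Fintype.prod_sum fun (i : Fin n) (z : Fin m → Bool) => ∏ j, ‖(q i j).1 (z j)‖ ^ 2]
      refine Finset.prod_eq_one fun i _ => ?_
      rw [← Fintype.prod_sum fun (j : Fin m) (c : Bool) => ‖(q i j).1 c‖ ^ 2]
      exact Finset.prod_eq_one fun j _ => (q i j).2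
    rw [h1]
    simp only [mul_one, ψ.2]⟩

/-- Bob aborts unless the check has succeeded. -/
def continueIf (ok : Bool) : OptionT PMF Unit := if ok = true then pure () else failure

/-- The order of the measurements: column by column, and in each column row by row. -/
def schedule (n m : ℕ) : List (Vertex n m) :=
  (List.finRange (m + 1)).flatMap fun j => (List.finRange n).map fun i => (i, j)

/-- The measurement of one vertex `v`. The current situation is Bob's register and the outcomes that
Alice has decoded so far. Alice sends `δ` and proves that it is correct, Bob measures and reports
`s'`, and Alice decodes `s' ⊕ r`. -/
def measurementRound (P : Primitives lam) (R : Resource) {n m : ℕ}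
    (Φ : Fin n → Fin (m + 1) → ZMod 8) (r : Fin n → Fin (m + 1) → Bool)
    (θ : Fin n → Fin (m + 1) → ZMod 8) (cφ : Fin n → Fin (m + 1) → P.com.Com × P.com.Dec)
    (st : QState (Vertex n m → Bool) × (Vertex n m → Bool)) (v : Vertex n m) :
    OptionT PMF (QState (Vertex n m → Bool) × (Vertex n m → Bool)) := do
  let sX := xDep st.2 v
  let sZ := zDep R st.2 v
  let φ' := adaptedAngle (Φ v.1 v.2) sX sZ
  let δ : ZMod 8 := φ' + θ v.1 v.2 + (if r v.1 v.2 = true then 4 else 0)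
  let ok ← P.zkAngle.run (δ, sZ, sX, (cφ v.1 v.2).1) (r v.1 v.2, θ v.1 v.2, φ', (cφ v.1 v.2).2)
  continueIf ok
  let out ← measureXY v (angle δ) st.1
  pure (out.2, Function.update st.2 v (xor out.1 (r v.1 v.2)))

/-- The honest run of the protocol on Alice's angles `Φ` and Bob's state `ψ`: the distribution of
Alice's output, where `none` means that Bob has aborted. -/
def honestRun (P : Primitives lam) (R : Resource) {n m : ℕ} (Φ : Fin n → Fin (m + 1) → ZMod 8)
    (ψ : QState (Bits n)) : PMF (Option (Bits n)) := OptionT.run do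
  -- Alice's randomness
  let rA ← (PMF.uniformOfFintype (Fin n → Fin (m + 1) → Bits lam) : PMF _)
  let r ← (PMF.uniformOfFintype (Fin n → Fin (m + 1) → Bool) : PMF _)
  -- Alice commits to her coins and to her angles
  let cf ← forGrid fun i j => P.com.commit (List.ofFn (rA i j))
  let cφ ← forGrid fun i j => P.com.commit (encodeAngle (Φ i j))
  -- Alice proves that she can open the commitments to the angles
  let _ ← forGrid fun i j => (do
    let ok ← P.zkOpen.run (cφ i j).1 ((cφ i j).2, encodeAngle (Φ i j))
    continueIf ok : OptionT PMF Unit)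
  -- Bob's coins
  let rB ← (PMF.uniformOfFintype (Fin n → Fin (m + 1) → Bits lam) : PMF _)
  -- Alice generates the keys and proves that they are generated from the joint coins
  let kt := fun i j => P.tdf.gen (bxor (rA i j) (rB i j))
  let _ ← forGrid fun i j => (do
    let ok ← P.zkKey.run ((kt i j).1, rB i j, (cf i j).1) (rA i j, (cf i j).2)
    continueIf ok : OptionT PMF Unit)
  -- remote preparation of all layers after the first
  let prep ← forGrid fun (i : Fin n) (j : Fin m) =>
    qfactory8 P.tdf (kt i j.succ).1 (kt i j.succ).2
  let θ : Fin n → Fin (m + 1) → ZMod 8 := fun i => Fin.cons 0 fun j => (prep i j).1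
  -- Bob entangles his input, the first layer, with the prepared qubits
  let register := (czGate (R.graph n m)).apply (gridState ψ fun i j => (prep i j).2)
  -- the measurements
  let final ← (schedule n m).foldlM (measurementRound P R Φ r θ cφ) (register, fun _ => false)
  pure fun i => final.2 (i, Fin.last m)

/-- Negligible functions of the security parameter. -/
def Negligible (ε : ℕ → ℝ) : Prop :=
  Asymptotics.SuperpolynomialDecay Filter.atTop (fun k : ℕ => (k : ℝ)) ε

/-- Functions bounded by a polynomial. -/
def PolyBounded (N : ℕ → ℕ) : Prop := ∃ p : Polynomial ℕ, ∀ k, N k ≤ p.eval k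

end Q2PC

end

/-!
# Correctness of the honest two-party computation

An honest run deviates from the ideal outcome only through three kinds of events: a rejected proof of
an opening, a rejected proof of a key, and, in one of the two runs of 4-states QFactory behind a
prepared qubit, an image that does not have two preimages or that the trapdoor does not invert.
The union bound for programs that may abort (`expect_run_bind_le`) adds up their probabilities. Alice's
key coins are masked by Bob's, so every key comes from uniform coins and the average over Bob's coins
of the preparation failure is governed by `εF` (`expect_badProb_coins_le`). Since the bound holds
for every test of the outcome (`expect_honestRun_le`), it bounds the total variation distance.

Outside these events the output has exactly the ideal distribution, for two reasons.

*Preparation.* If the image `y` has the preimages `x, x'`, Bob's first measurement leaves a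
superposition of `x` and `x'`, and whatever he measures next, his qubit is the state
`(|0⟩ + w|1⟩)/√2` with the phase `w` that Alice computes (`isPlus_of_two_preimages`). Merging keeps
this form (`bobMerge_isPlus`). Global phases are disregarded by the predicate `IsPlus`.

*Measurement pattern.* In an adaptive measurement of all vertices, the probability of a run of
outcomes is the squared modulus of one amplitude (`expect_foldlM_adaptiveStep`), a sum over all
labellings `a` of the grid by bits. The mask `r` and the remote angles `θ` cancel from it. Let `t` be
the decoded outcomes. Substituting `a ↦ a ⊕ s^X(t)` turns the angles `(-1)^{s^X} φ` into `φ`, and the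
signs of the controlled-`Z` gates produce at each vertex the parity of `s^X` over its neighbours. By
the flow condition (`sgn_flow`) this cancels `s^Z` and all outcomes except those of the last column.
What remains is, up to a factor of fixed modulus, the sum over paths of the amplitude of the encoded
unitary at the outcomes of the last column (`norm_adaptedSum`, `encodedUnitary_apply`).
-/

noncomputable section

namespace Q2PC

variable {lam : ℕ}

/-! ### Expectations and failure probabilities -/

/-- The expectation of a nonnegative function of the outcome. -/
def expect {α : Type} (p : PMF α) (g : α → ENNReal) : ENNReal := ∑' a, p a * g a

/-- The probability that the outcome lies outside `G`. -/
def failProb {α : Type} (p : PMF α) (G : Set α) : ENNReal := expect p (Gᶜ.indicator 1)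

theorem expect_bind {α β : Type} (p : PMF α) (k : α → PMF β) (g : β → ENNReal) :
    expect (p >>= k) g = expect p fun a => expect (k a) g := by
  change ∑' b, (p.bind k) b * g b = ∑' a, p a * ∑' b, k a b * g b
  simp only [PMF.bind_apply, ← ENNReal.tsum_mul_right, ← ENNReal.tsum_mul_left]
  rw [ENNReal.tsum_comm]
  simp only [mul_assoc]

theorem expect_pure {α : Type} (a : α) (g : α → ENNReal) : expect (pure a : PMF α) g = g a := by
  change ∑' b, (PMF.pure a) b * g b = g a
  rw [tsum_eq_single a]
  · simp
  · intro b hb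
    simp [hb]

theorem expect_map {α β : Type} (f : α → β) (p : PMF α) (g : β → ENNReal) :
    expect (p.map f) g = expect p (g ∘ f) := by
  have h : p.map f = p >>= fun a => pure (f a) := rfl
  rw [h, expect_bind]
  simp only [expect_pure]
  rfl

theorem expect_const {α : Type} (p : PMF α) (c : ENNReal) : expect p (fun _ => c) = c := by
  simp [expect, ENNReal.tsum_mul_right, p.tsum_coe]

theorem expect_mono {α : Type} (p : PMF α) {f g : α → ENNReal}
    (h : ∀ a ∈ p.support, f a ≤ g a) : expect p f ≤ expect p g := by
  refine ENNReal.tsum_le_tsum fun a => ?_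
  by_cases ha : a ∈ p.support
  · exact mul_le_mul_right (h a ha) _
  · simp [(p.apply_eq_zero_iff a).mpr ha]

theorem expect_congr {α : Type} (p : PMF α) {f g : α → ENNReal}
    (h : ∀ a ∈ p.support, f a = g a) : expect p f = expect p g :=
  le_antisymm (expect_mono p fun a ha => (h a ha).le) (expect_mono p fun a ha => (h a ha).ge)

theorem expect_add {α : Type} (p : PMF α) (f g : α → ENNReal) :
    expect p (fun a => f a + g a) = expect p f + expect p g := by
  simp [expect, mul_add, ENNReal.tsum_add]

theorem expect_sum {α κ : Type} (p : PMF α) (s : Finset κ) (f : κ → α → ENNReal) :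
    expect p (fun a => ∑ k ∈ s, f k a) = ∑ k ∈ s, expect p (f k) := by
  classical
  induction s using Finset.induction_on with
  | empty => simp [expect]
  | insert k s hk ih => simp only [Finset.sum_insert hk, expect_add, ih]

theorem expect_fintype {α : Type} [Fintype α] (p : PMF α) (g : α → ENNReal) :
    expect p g = ∑ a, p a * g a := tsum_fintype _

theorem expect_le_one {α : Type} (p : PMF α) {g : α → ENNReal} (hg : ∀ a, g a ≤ 1) :
    expect p g ≤ 1 :=
  (expect_mono p fun a _ => hg a).trans (expect_const p 1).le

theorem indicator_compl_le_one {α : Type} (G : Set α) (a : α) :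
    (Gᶜ.indicator 1 : α → ENNReal) a ≤ 1 :=
  Set.indicator_le_self' (fun _ _ => zero_le_one) a

theorem failProb_le_one {α : Type} (p : PMF α) (G : Set α) : failProb p G ≤ 1 :=
  expect_le_one p (indicator_compl_le_one G)

theorem failProb_eq_zero {α : Type} (p : PMF α) (G : Set α) (h : ∀ a ∈ p.support, a ∈ G) :
    failProb p G = 0 := by
  have h' : failProb p G = expect p fun _ => 0 := expect_congr p fun a ha => by simp [h a ha]
  rw [h', expect_const]

/-- The union bound for a test `h`: outside `G` the test costs at most `1`. -/
theorem expect_le_add_failProb {α : Type} (p : PMF α) (G : Set α) {h : α → ENNReal}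
    (h1 : ∀ a, h a ≤ 1) {c : ENNReal} (hc : ∀ a ∈ G, h a ≤ c) :
    expect p h ≤ c + failProb p G := by
  calc expect p h ≤ expect p (fun a => c + (Gᶜ.indicator 1 : α → ENNReal) a) := by
        refine expect_mono p fun a _ => ?_
        by_cases ha : a ∈ G
        · simpa [ha] using hc a ha
        · simpa [ha] using (h1 a).trans le_add_self
    _ = c + failProb p G := by rw [expect_add, expect_const, failProb]

theorem failProb_bind_le {α β : Type} (p : PMF α) (k : α → PMF β) (G : Set α) (G' : Set β)
    {c : ENNReal} (hc : ∀ a ∈ G, failProb (k a) G' ≤ c) :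
    failProb (p >>= k) G' ≤ c + failProb p G := by
  rw [failProb, expect_bind]
  exact expect_le_add_failProb p G (fun a => failProb_le_one _ _) hc

/-! ### Programs that may abort -/

theorem run_lift_bind {α β : Type} (p : PMF α) (k : α → OptionT PMF β) :
    ((liftM p : OptionT PMF α) >>= k).run = p >>= fun a => (k a).run := by
  change ((OptionT.lift p) >>= k).run = _
  rw [OptionT.run_bind, OptionT.run_lift]
  simp [Option.elimM]

theorem run_lift {α : Type} (p : PMF α) : (liftM p : OptionT PMF α).run = p.map some := rfl

theorem failProb_lift {α : Type} (p : PMF α) (G : Set α) :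
    failProb (liftM p : OptionT PMF α).run (some '' G) = failProb p G := by
  rw [run_lift, failProb, expect_map, failProb]
  congr 1
  funext a
  by_cases ha : a ∈ G <;> simp [ha]

/-- An aborted first part hands on the value of the test at `none`. -/
theorem expect_run_bind {α β : Type} (p : OptionT PMF α) (k : α → OptionT PMF β)
    (h : Option β → ENNReal) :
    expect (p >>= k).run h = expect p.run fun o => o.elim (h none) fun a => expect (k a).run h := by
  rw [OptionT.run_bind, Option.elimM, expect_bind]
  congr 1
  funext o
  cases o
  · simp [expect_pure]
  · rfl

/-- The union bound for programs that may abort. -/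
theorem expect_run_bind_le {α β : Type} (p : OptionT PMF α) (k : α → OptionT PMF β)
    (G : Set α) {h : Option β → ENNReal} (h1 : ∀ o, h o ≤ 1) {c ε : ENNReal}
    (hp : failProb p.run (some '' G) ≤ ε) (hc : ∀ a ∈ G, expect (k a).run h ≤ c) :
    expect (p >>= k).run h ≤ c + ε := by
  rw [expect_run_bind]
  refine (expect_le_add_failProb p.run (some '' G) ?_ ?_).trans (add_le_add le_rfl hp)
  · rintro (_ | a)
    · exact h1 none
    · exact expect_le_one _ h1
  · rintro _ ⟨a, ha, rfl⟩
    exact hc a ha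

theorem failProb_run_bind_le {α β : Type} (p : OptionT PMF α) (k : α → OptionT PMF β)
    (G : Set α) (G' : Set β) {c ε : ENNReal} (hp : failProb p.run (some '' G) ≤ ε)
    (hc : ∀ a ∈ G, failProb (k a).run (some '' G') ≤ c) :
    failProb (p >>= k).run (some '' G') ≤ c + ε :=
  expect_run_bind_le p k G (indicator_compl_le_one _) hp hc

theorem failProb_run_pure {α : Type} (a : α) (G : Set α) (ha : a ∈ G) :
    failProb (pure a : OptionT PMF α).run (some '' G) = 0 := by
  refine failProb_eq_zero _ _ fun o ho => ?_
  have h : o = some a := (PMF.mem_support_pure_iff _ _).mp ho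
  exact ⟨a, ha, h.symm⟩

/-- In a loop the failure probabilities of the passes add up. -/
theorem failProb_forAll_le {α : Type} : ∀ (k : ℕ) (p : Fin k → OptionT PMF α)
    (G : Fin k → Set α) (ε : Fin k → ENNReal)
    (_ : ∀ i, failProb (p i).run (some '' G i) ≤ ε i),
    failProb (forAll k p).run (some '' {a | ∀ i, a i ∈ G i}) ≤ ∑ i, ε i
  | 0, p, G, ε, _ => by
    rw [forAll, failProb_run_pure]
    · simp
    · intro i
      exact i.elim0
  | k + 1, p, G, ε, hp => by
    rw [forAll, Fin.sum_univ_succ]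
    refine (failProb_run_bind_le _ _ (G 0) _ (hp 0) (c := ∑ i, ε (Fin.succ i))
      fun a ha => ?_).trans_eq (add_comm _ _)
    have ih := failProb_forAll_le k (fun i => p i.succ) (fun i => G i.succ) (fun i => ε i.succ)
      fun i => hp i.succ
    rw [← zero_add (∑ i, ε (Fin.succ i))]
    refine failProb_run_bind_le _ _ _ _ ih fun rest hrest => ?_
    refine (failProb_run_pure _ _ fun i => ?_).le
    refine Fin.cases ?_ (fun i => ?_) i
    · simpa using ha
    · simpa using hrest i

theorem failProb_forGrid_le {α : Type} {n k : ℕ} (p : Fin n → Fin k → OptionT PMF α)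
    (G : Fin n → Fin k → Set α) (ε : Fin n → Fin k → ENNReal)
    (hp : ∀ i j, failProb (p i j).run (some '' G i j) ≤ ε i j) :
    failProb (forGrid p).run (some '' {a | ∀ i j, a i j ∈ G i j}) ≤ ∑ i, ∑ j, ε i j := by
  have h := fun i => failProb_forAll_le k (p i) (G i) (ε i) (hp i)
  exact failProb_forAll_le n (fun i => forAll k fun j => p i j) (fun i => {a | ∀ j, a j ∈ G i j})
    (fun i => ∑ j, ε i j) h

/-- A check that succeeds with probability at least `1 - ε`. -/
theorem failProb_check_le (p : PMF Bool) {ε : ℝ} (hp : 1 - ε ≤ (p true).toReal) :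
    failProb (do let ok ← (liftM p : OptionT PMF Bool); continueIf ok : OptionT PMF Unit).run
      (some '' Set.univ) ≤ ENNReal.ofReal ε := by
  rw [← zero_add (ENNReal.ofReal ε)]
  refine failProb_run_bind_le _ _ {true} _ ?_ ?_
  · rw [failProb_lift, failProb, expect_fintype, Fintype.sum_bool]
    have h1 : p true + p false = 1 := by
      rw [← p.tsum_coe, tsum_fintype, Fintype.sum_bool]
    have h2 : (p true).toReal + (p false).toReal = 1 := by
      rw [← ENNReal.toReal_add (p.apply_ne_top _) (p.apply_ne_top _), h1, ENNReal.toReal_one]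
    simp only [Set.mem_compl_iff, Set.mem_singleton_iff, not_true_eq_false, not_false_eq_true,
      Set.indicator_of_notMem, Set.indicator_of_mem, Pi.one_apply, mul_zero, mul_one, zero_add,
      reduceCtorEq]
    rw [← ENNReal.ofReal_toReal (p.apply_ne_top false)]
    exact ENNReal.ofReal_le_ofReal (by linarith)
  · rintro _ rfl
    exact (failProb_run_pure () Set.univ trivial).le

theorem eq_pure_true_of_complete (p : PMF Bool) (hp : 1 ≤ (p true).toReal) : p = pure true := by
  have h : p true = 1 := by
    refine le_antisymm (p.coe_le_one _) ?_
    rw [← ENNReal.toReal_one] at hp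
    exact (ENNReal.toReal_le_toReal ENNReal.one_ne_top (p.apply_ne_top _)).mp hp
  have hs := (p.apply_eq_one_iff true).mp h
  refine PMF.ext fun b => ?_
  change p b = PMF.pure true b
  cases b
  · have : false ∉ p.support := by simp [hs]
    rw [(p.apply_eq_zero_iff _).mpr this]
    simp
  · rw [h]
    simp

/-! ### Total variation distance -/

/-- A one-sided bound on all tests bounds the total variation distance: the best test is
the set on which the first distribution exceeds the second. -/
theorem tvDist_le_of_expect_le {α : Type} [Fintype α] (p q : PMF α) {ε : ℝ} (hε : 0 ≤ ε)
    (h : ∀ g : α → ENNReal, (∀ a, g a ≤ 1) → expect p g ≤ expect q g + ENNReal.ofReal ε) :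
    tvDist p q ≤ ε := by
  classical
  have hreal : ∀ (r : PMF α) (s : Finset α),
      (expect r fun a => if a ∈ s then 1 else 0) = ENNReal.ofReal (∑ a ∈ s, (r a).toReal) := by
    intro r s
    rw [expect_fintype, ENNReal.ofReal_sum_of_nonneg fun a _ => ENNReal.toReal_nonneg]
    simp [ENNReal.ofReal_toReal (r.apply_ne_top _)]
  have htot : ∀ r : PMF α, ∑ a, (r a).toReal = 1 := by
    intro r
    have h1 := r.tsum_coe
    rw [tsum_fintype] at h1
    rw [← ENNReal.toReal_sum fun a _ => r.apply_ne_top a, h1, ENNReal.toReal_one]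
  set s : Finset α := Finset.univ.filter fun a => (q a).toReal ≤ (p a).toReal with hs
  have h1 := h (fun a => if a ∈ s then 1 else 0) fun a => by split_ifs <;> simp
  rw [hreal, hreal, ← ENNReal.ofReal_add (Finset.sum_nonneg fun _ _ => ENNReal.toReal_nonneg) hε,
    ENNReal.ofReal_le_ofReal_iff
      (add_nonneg (Finset.sum_nonneg fun _ _ => ENNReal.toReal_nonneg) hε)] at h1
  -- `|x| = 2 max(x, 0) - x`, and the differences sum to zero
  have habs : ∑ a, |(p a).toReal - (q a).toReal| =
      ∑ a, (2 * (if a ∈ s then (p a).toReal - (q a).toReal else 0)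
        - ((p a).toReal - (q a).toReal)) := by
    refine Finset.sum_congr rfl fun a _ => ?_
    by_cases ha : (q a).toReal ≤ (p a).toReal
    · rw [abs_of_nonneg (by linarith), if_pos (by simp [hs, ha])]
      ring
    · rw [abs_of_neg (by linarith), if_neg (by simp [hs, ha])]
      ring
  rw [tvDist, habs, Finset.sum_sub_distrib, ← Finset.mul_sum, Finset.sum_sub_distrib, htot, htot,
    ← Finset.sum_filter, Finset.sum_sub_distrib]
  simp only [Finset.filter_mem_eq_inter, Finset.univ_inter]
  linarith

theorem tvDist_nonneg {α : Type} [Fintype α] (p q : PMF α) : 0 ≤ tvDist p q :=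
  mul_nonneg (by norm_num) (Finset.sum_nonneg fun _ _ => abs_nonneg _)

theorem eq_of_tvDist_le_zero {α : Type} [Fintype α] {p q : PMF α} (h : tvDist p q ≤ 0) :
    p = q := by
  have h0 : ∑ a, |(p a).toReal - (q a).toReal| = 0 := by
    refine le_antisymm ?_ (Finset.sum_nonneg fun _ _ => abs_nonneg _)
    rw [tvDist] at h
    linarith
  refine PMF.ext fun a => ?_
  have ha := (Finset.sum_eq_zero_iff_of_nonneg fun _ _ => abs_nonneg _).mp h0 a (Finset.mem_univ a)
  rw [abs_eq_zero, sub_eq_zero] at ha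
  exact (ENNReal.toReal_eq_toReal_iff' (p.apply_ne_top _) (q.apply_ne_top _)).mp ha

/-! ### Uniform families -/

/-- Every coordinate of a uniform family is uniform. -/
theorem expect_uniform_eval {κ α : Type} [Fintype κ] [DecidableEq κ] [Fintype α] [Nonempty α]
    (i : κ) (g : α → ENNReal) :
    expect (PMF.uniformOfFintype (κ → α)) (fun a => g (a i)) =
      expect (PMF.uniformOfFintype α) g := by
  have hcard : Fintype.card (κ → α) = Fintype.card α * Fintype.card ({j // j ≠ i} → α) := by
    rw [← Fintype.card_prod]
    exact Fintype.card_congr (Equiv.funSplitAt i α)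
  have hsum : ∑ f : κ → α, g (f i) = Fintype.card ({j // j ≠ i} → α) * ∑ a, g a := by
    rw [← Equiv.sum_comp (Equiv.funSplitAt i α).symm, Fintype.sum_prod_type, Finset.mul_sum]
    refine Finset.sum_congr rfl fun a _ => ?_
    simp [Equiv.funSplitAt, Equiv.piSplitAt]
  have h0 : (Fintype.card ({j // j ≠ i} → α) : ENNReal) ≠ 0 := by
    exact_mod_cast Fintype.card_ne_zero
  simp only [expect_fintype, PMF.uniformOfFintype_apply, ← Finset.mul_sum]
  rw [hsum, hcard, Nat.cast_mul, ENNReal.mul_inv (Or.inr (ENNReal.natCast_ne_top _)) (Or.inr h0),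
    mul_assoc, ← mul_assoc (_⁻¹ : ENNReal) (_ : ENNReal) (∑ a, g a),
    ENNReal.inv_mul_cancel h0 (ENNReal.natCast_ne_top _), one_mul]

/-! ### Phases and signs -/

/-- The sign `(-1)^b`. -/
def sgn (b : Bool) : ℂ := if b = true then -1 else 1

@[simp] theorem sgn_false : sgn false = 1 := rfl

@[simp] theorem sgn_true : sgn true = -1 := rfl

theorem sgn_xor (a b : Bool) : sgn (xor a b) = sgn a * sgn b := by
  cases a <;> cases b <;> simp

theorem sgn_mul_self (a : Bool) : sgn a * sgn a = 1 := by
  cases a <;> simp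

theorem norm_sgn (a : Bool) : ‖sgn a‖ = 1 := by
  cases a <;> simp

theorem sgn_decide_odd (k : ℕ) : sgn (decide (Odd k)) = (-1) ^ k := by
  by_cases h : Odd k
  · simp [h, h.neg_one_pow]
  · simp [h, (Nat.not_odd_iff_even.mp h).neg_one_pow]

/-- The parity of the number of indices with a property is the product of their signs. -/
theorem sgn_decide_odd_card {κ : Type} [Fintype κ] (p : κ → Prop) [DecidablePred p] :
    sgn (decide (Odd (Finset.univ.filter p).card)) = ∏ k, sgn (decide (p k)) := by
  rw [sgn_decide_odd, ← Finset.prod_const, Finset.prod_filter]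
  refine Finset.prod_congr rfl fun k _ => ?_
  by_cases h : p k <;> simp [h]

theorem sgn_dotBit {κ : Type} [Fintype κ] (x y : κ → Bool) :
    sgn (dotBit x y) = ∏ k, sgn (x k && y k) := by
  rw [dotBit, sgn_decide_odd_card]
  simp

theorem sgn_dotBit_bxor {κ : Type} [Fintype κ] (b x y : κ → Bool) :
    sgn (dotBit b (bxor x y)) = sgn (dotBit b x) * sgn (dotBit b y) := by
  simp only [sgn_dotBit, ← Finset.prod_mul_distrib, bxor, ← sgn_xor]
  refine Finset.prod_congr rfl fun k _ => ?_
  cases b k <;> simp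

/-- The factor `1 / √2`. -/
def rt : ℂ := (((Real.sqrt 2)⁻¹ : ℝ) : ℂ)

theorem rt_ne_zero : rt ≠ 0 := by
  simp [rt]

theorem norm_rt_sq : ‖rt‖ ^ 2 = 1 / 2 := by
  rw [rt, Complex.norm_real, Real.norm_eq_abs, sq_abs, inv_pow, Real.sq_sqrt (by norm_num)]
  norm_num

theorem hadamard_apply (a b : Bool) : hadamard.1 a b = rt * sgn (a && b) := by
  cases a <;> cases b <;> rfl

theorem tensorGate_hadamard_apply {κ : Type} [Fintype κ] [DecidableEq κ] (a b : κ → Bool) :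
    (tensorGate fun _ : κ => hadamard).1 a b = rt ^ Fintype.card κ * sgn (dotBit a b) := by
  change ∏ q, hadamard.1 (a q) (b q) = _
  simp only [hadamard_apply, Finset.prod_mul_distrib, Finset.prod_const, sgn_dotBit,
    Finset.card_univ]

/-- The number `e^{iθ}` for the angle `θ = aπ/4`. -/
def phase (a : ZMod 8) : ℂ := Complex.exp (angle a * Complex.I)

theorem phase_eq_pow (a : ZMod 8) :
    phase a = Complex.exp ((Real.pi / 4 : ℝ) * Complex.I) ^ a.val := by
  rw [phase, angle, ← Complex.exp_nat_mul]
  push_cast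
  congr 1
  ring

theorem phase_zero : phase 0 = 1 := by
  simp [phase, angle]

theorem phase_four : phase 4 = -1 := by
  have h : angle 4 = Real.pi := by
    rw [angle, show (4 : ZMod 8).val = 4 from rfl]
    push_cast
    ring
  rw [phase, h, Complex.exp_pi_mul_I]

theorem phase_two : phase 2 = Complex.I := by
  have h : angle 2 = Real.pi / 2 := by
    rw [angle, show (2 : ZMod 8).val = 2 from rfl]
    push_cast
    ring
  rw [phase, h]
  push_cast
  exact Complex.exp_pi_div_two_mul_I

theorem phase_add (a b : ZMod 8) : phase (a + b) = phase a * phase b := by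
  have h8 : Complex.exp ((Real.pi / 4 : ℝ) * Complex.I) ^ 8 = 1 := by
    rw [← Complex.exp_nat_mul, ← Complex.exp_two_pi_mul_I]
    push_cast
    congr 1
    ring
  rw [phase_eq_pow, phase_eq_pow, phase_eq_pow, ZMod.val_add, ← pow_add, ← pow_mod_orderOf,
    ← pow_mod_orderOf _ (a.val + b.val), Nat.mod_mod_of_dvd _ (orderOf_dvd_of_pow_eq_one h8)]

theorem norm_phase (a : ZMod 8) : ‖phase a‖ = 1 :=
  Complex.norm_exp_ofReal_mul_I _

theorem phase_neg (a : ZMod 8) : phase (-a) = (phase a)⁻¹ := by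
  refine eq_inv_of_mul_eq_one_left ?_
  rw [← phase_add, neg_add_cancel, phase_zero]

theorem phase_ne_zero (a : ZMod 8) : phase a ≠ 0 := Complex.exp_ne_zero _

theorem phase_ite_four (b : Bool) : phase (if b = true then 4 else 0) = sgn b := by
  cases b <;> simp [phase_zero, phase_four]

theorem exp_neg_angle (a : ZMod 8) : Complex.exp ((-angle a : ℝ) * Complex.I) = (phase a)⁻¹ := by
  rw [phase, ← Complex.exp_neg]
  push_cast
  ring_nf

/-- For `w` of modulus one: the single-qubit state is `(|0⟩ + w|1⟩)/√2` up to a global phase. A state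
is normalized, so it suffices to compare its two amplitudes, which leaves the phase free. -/
def IsPlus (w : ℂ) (q : QState Bool) : Prop := q.1 true = w * q.1 false

/-! ### Measuring the second register -/

/-- The amplitudes of a gate on the second register. -/
theorem onSnd_apply {ι κ : Type} [Fintype ι] [DecidableEq ι] [Fintype κ] [DecidableEq κ]
    (U : Gate κ) (ψ : QState (ι × κ)) (i : ι) (k : κ) :
    ((onSnd U).apply ψ).1 (i, k) = ∑ k', U.1 k k' * ψ.1 (i, k') := by
  change ∑ p : ι × κ, ((1 : Matrix ι ι ℂ) i p.1 * U.1 k p.2) * ψ.1 p = _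
  rw [Fintype.sum_prod_type, Finset.sum_eq_single i]
  · simp
  · intro j _ hj
    simp [Matrix.one_apply_ne hj.symm]
  · simp

theorem normalize_apply {ι : Type} [Fintype ι] {v : ι → ℂ} (h : ∑ k, ‖v k‖ ^ 2 ≠ 0)
    (fb : QState ι) (k : ι) :
    (normalize v fb).1 k = ((Real.sqrt (∑ k, ‖v k‖ ^ 2) : ℝ) : ℂ)⁻¹ * v k := by
  have hn : normalize v fb = ⟨fun i => v i / ((Real.sqrt (∑ k, ‖v k‖ ^ 2) : ℝ) : ℂ), _⟩ :=
    dif_neg h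
  rw [hn]
  exact div_eq_inv_mul _ _

theorem normalize_eq_smul {ι : Type} [Fintype ι] {v : ι → ℂ} {i : ι} (hi : v i ≠ 0)
    (fb : QState ι) : ∃ c : ℂ, ∀ k, (normalize v fb).1 k = c * v k := by
  have h : ∑ k, ‖v k‖ ^ 2 ≠ 0 := by
    refine (Finset.sum_pos' (fun k _ => by positivity) ⟨i, Finset.mem_univ i, ?_⟩).ne'
    have := norm_pos_iff.mpr hi
    positivity
  exact ⟨_, normalize_apply h fb⟩

theorem expect_measureSnd {ι κ : Type} [Fintype ι] [DecidableEq ι] [Inhabited ι] [Fintype κ]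
    (ψ : QState (ι × κ)) (g : κ × QState ι → ENNReal) :
    expect (measureSnd ψ) g = ∑ p, ENNReal.ofReal (‖ψ.1 p‖ ^ 2) *
      g (p.2, normalize (fun a => ψ.1 (a, p.2)) (ket default)) := by
  rw [measureSnd, expect_bind, expect_fintype]
  simp only [expect_pure]
  rfl

/-- After a possible outcome `x` the remaining register is proportional to the slice of the state
at `x`. -/
theorem measureSnd_support {ι κ : Type} [Fintype ι] [DecidableEq ι] [Inhabited ι] [Fintype κ]
    (ψ : QState (ι × κ)) {x : κ × QState ι} (hx : x ∈ (measureSnd ψ).support) :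
    ∃ c : ℂ, ∀ a, x.2.1 a = c * ψ.1 (a, x.1) := by
  obtain ⟨p, hp, hpx⟩ := (PMF.mem_support_bind_iff _ _ _).mp hx
  obtain rfl := (PMF.mem_support_pure_iff _ _).mp hpx
  have h0 : ψ.1 (p.1, p.2) ≠ 0 := by
    intro h0
    refine (PMF.mem_support_iff _ _).mp hp ?_
    change ENNReal.ofReal (‖ψ.1 p‖ ^ 2) = 0
    rw [show ψ.1 p = 0 from h0]
    simp
  exact normalize_eq_smul (v := fun a => ψ.1 (a, p.2)) h0 _

/-! ### 4-states QFactory -/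

/-- The probability over the input that an image under the key from the coins `r` is not
two-to-one or not inverted by the trapdoor. -/
def TrapdoorFamily.badProb (F : TrapdoorFamily lam) (r : Bits lam) : ENNReal :=
  failProb (PMF.uniformOfFintype (Bits F.inLen)) {x | F.Good r x}

/-- The phase `(-1)^{θ₁} i^{θ₂}` of a 4-states output. -/
def phase4 (θ : Bool × Bool) : ℂ :=
  phase ((if θ.1 = true then 4 else 0) + if θ.2 = true then 2 else 0)

theorem phase4_eq (θ : Bool × Bool) :
    phase4 θ = sgn θ.1 * if θ.2 = true then Complex.I else 1 := by
  rw [phase4, phase_add, phase_ite_four]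
  cases θ.2 <;> simp [phase_two, phase_zero]

/-- The second half of 4-states QFactory: the superposition of the two preimages leads to the
state that Alice computes, whatever Bob measures. -/
theorem isPlus_of_two_preimages {l : ℕ} (h : Bits l → Bool) (p : Bits l × Bits l) (hp : p.1 ≠ p.2)
    (χ : QState (Bool × Bits l)) {c : ℂ}
    (hχ : ∀ a x, χ.1 (a, x) = if a = false ∧ (x = p.1 ∨ x = p.2) then c else 0)
    {mb : Bits l × QState Bool}
    (hmb : mb ∈ (measureSnd ((onSnd (tensorGate fun _ => hadamard)).apply
      (permute (oracleBit h) χ))).support) :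
    IsPlus (phase4 (xor (xor (h p.1) (h p.2) && dotBit mb.1 (bxor p.1 p.2)) (h p.1 && h p.2),
      xor (h p.1) (h p.2))) ((hadamard * rotZ (-(Real.pi / 2))).apply mb.2) := by
  obtain ⟨d, hd⟩ := measureSnd_support _ hmb
  -- the predicate of each preimage is written to the output qubit
  have hperm : ∀ a x, (permute (oracleBit h) χ).1 (a, x) =
      (if x = p.1 then (if a = h p.1 then c else 0) else 0) +
      (if x = p.2 then (if a = h p.2 then c else 0) else 0) := by
    intro a x
    change χ.1 (xor a (h x), x) = _
    rw [hχ]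
    by_cases h1 : x = p.1
    · subst h1
      rw [if_neg hp]
      cases a <;> cases h p.1 <;> simp
    · by_cases h2 : x = p.2
      · subst h2
        rw [if_neg h1]
        cases a <;> cases h p.2 <;> simp
      · simp [h1, h2]
  -- the outcome `b` leaves the relative sign `(-1)^⟨b, x ⊕ x'⟩` between the two branches
  have hmb2 : ∀ a, mb.2.1 a = d * rt ^ l * c * sgn (dotBit mb.1 p.1) *
      ((if a = h p.1 then 1 else 0) +
        (if a = h p.2 then sgn (dotBit mb.1 (bxor p.1 p.2)) else 0)) := by
    intro a
    rw [hd, onSnd_apply]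
    simp only [tensorGate_hadamard_apply, hperm, mul_add, Finset.sum_add_distrib, mul_ite,
      mul_zero, Finset.sum_ite_eq', Finset.mem_univ, if_true, sgn_dotBit_bxor, Fintype.card_fin]
    have := sgn_mul_self (dotBit mb.1 p.1)
    congr 1
    · split_ifs <;> ring
    · split_ifs
      · linear_combination (-d * rt ^ l * c * sgn (dotBit mb.1 p.2)) * this
      · ring
  have hg : ∀ a, ((hadamard * rotZ (-(Real.pi / 2))).apply mb.2).1 a =
      rt * (mb.2.1 false - Complex.I * sgn a * mb.2.1 true) := by
    intro a
    have he : Complex.exp (((-(Real.pi / 2) : ℝ) : ℂ) * Complex.I) = -Complex.I := by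
      have := exp_neg_angle 2
      rw [phase_two, Complex.inv_I] at this
      rw [← this, angle, show (2 : ZMod 8).val = 2 from rfl]
      push_cast
      ring_nf
    change ((hadamard * rotZ (-(Real.pi / 2))).1.mulVec mb.2.1) a = _
    simp only [Matrix.mulVec, dotProduct, Fintype.sum_bool, Submonoid.coe_mul, Matrix.mul_apply,
      hadamard_apply, rotZ, diagGate, Matrix.diagonal_apply, he]
    cases a <;> simp <;> ring
  rw [IsPlus, hg, hg, hmb2, hmb2, phase4_eq]
  generalize dotBit mb.1 (bxor p.1 p.2) = b
  generalize d * rt ^ l * c * sgn (dotBit mb.1 p.1) = e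
  have hI := Complex.I_mul_I
  cases h p.1 <;> cases h p.2 <;> cases b <;> simp <;>
    first
      | ring1
      | linear_combination (rt * e) * hI
      | linear_combination (-rt * e) * hI

/-- The state before Bob's first measurement: a uniform superposition of the inputs next to their
images. -/
def imageState (F : TrapdoorFamily lam) (k : F.Key) :
    QState ((Bool × Bits F.inLen) × Bits F.outLen) :=
  permute (oracleBits (F.eval k)) (prodState ((onSnd (tensorGate fun _ => hadamard)).apply
    (prodState (ket false) (ket fun _ => false))) (ket fun _ => false))

theorem imageState_apply (F : TrapdoorFamily lam) (k : F.Key) (a : Bool) (x : Bits F.inLen)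
    (y : Bits F.outLen) :
    (imageState F k).1 ((a, x), y) = if a = false ∧ y = F.eval k x then rt ^ F.inLen else 0 := by
  change ((onSnd (tensorGate fun _ => hadamard)).apply
      (prodState (ket false) (ket fun _ => false))).1 (a, x) *
      (Pi.single (fun _ => false) 1 : Bits F.outLen → ℂ) (bxor y (F.eval k x)) = _
  have hy : bxor y (F.eval k x) = (fun _ => false) ↔ y = F.eval k x := by
    simp only [funext_iff, bxor]
    refine forall_congr' fun i => ?_
    cases y i <;> cases F.eval k x i <;> simp
  have ha : ∀ x', (prodState (ket false) (ket fun _ => false) : QState (Bool × Bits F.inLen)).1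
      (a, x') = if x' = (fun _ => false) then (if a = false then 1 else 0) else 0 := by
    intro x'
    change (Pi.single false 1 : Bool → ℂ) a *
      (Pi.single (fun _ => false) 1 : Bits F.inLen → ℂ) x' = _
    by_cases h : x' = fun _ => false <;> cases a <;> simp [h]
  have h0 : dotBit x (fun _ => false) = false := by
    simp [dotBit]
  rw [onSnd_apply]
  simp only [ha, mul_ite, mul_zero, Finset.sum_ite_eq', Finset.mem_univ, if_true,
    tensorGate_hadamard_apply, h0, Pi.single_apply, hy, sgn_false, Fintype.card_fin]
  by_cases h1 : y = F.eval k x <;> by_cases h2 : a = false <;> simp [h1, h2]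

/-- With a key generated from the coins `r`, the 4-states protocol fails only on an input for which
two-regularity or inversion fails. -/
theorem failProb_bobQFactory4_le (F : TrapdoorFamily lam) (r : Bits lam) :
    failProb (bobQFactory4 F (F.gen r).1)
      {out | IsPlus (phase4 (aliceQFactory4 F (F.gen r).1 (F.gen r).2 out.1)) out.2} ≤
      F.badProb r := by
  set k := (F.gen r).1 with hk
  have hbob : bobQFactory4 F k = measureSnd (imageState F k) >>= fun my =>
      measureSnd ((onSnd (tensorGate fun _ => hadamard)).apply
        (permute (oracleBit (F.pred k)) my.2)) >>= fun mb =>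
      pure ((my.1, mb.1), (hadamard * rotZ (-(Real.pi / 2))).apply mb.2) := rfl
  rw [hbob, failProb, expect_bind, expect_measureSnd, Fintype.sum_prod_type,
    Fintype.sum_prod_type, TrapdoorFamily.badProb, failProb, expect_fintype]
  simp only [imageState_apply]
  rw [Fintype.sum_bool]
  -- each input carries the weight `2^{-l}`, the probability of a uniform input
  have hw : ENNReal.ofReal (‖rt ^ F.inLen‖ ^ 2) =
      ((Fintype.card (Bits F.inLen) : ENNReal))⁻¹ := by
    rw [norm_pow, ← pow_mul, mul_comm, pow_mul, norm_rt_sq, one_div, inv_pow,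
      ENNReal.ofReal_inv_of_pos (by positivity)]
    congr 1
    rw [ENNReal.ofReal_pow (by norm_num)]
    simp
  simp only [reduceCtorEq, false_and, if_false, norm_zero, ne_eq, OfNat.ofNat_ne_zero,
    not_false_eq_true, zero_pow, ENNReal.ofReal_zero, zero_mul, Finset.sum_const_zero, zero_add,
    true_and, PMF.uniformOfFintype_apply]
  refine Finset.sum_le_sum fun x _ => ?_
  rw [Finset.sum_eq_single (F.eval k x) _ (by simp)]
  swap
  · intro y _ hy
    simp [hy]
  rw [if_pos rfl, hw]
  refine mul_le_mul_right ?_ _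
  by_cases hx : F.Good r x
  · refine (le_of_eq ?_).trans zero_le
    refine failProb_eq_zero _ _ fun out hout => ?_
    obtain ⟨mb, hmb, hout⟩ := (PMF.mem_support_bind_iff _ _ _).mp hout
    obtain rfl := (PMF.mem_support_pure_iff _ _).mp hout
    obtain ⟨hne, hpre⟩ := hx
    obtain ⟨c, hc⟩ := normalize_eq_smul (i := (false, x))
      (v := fun a => (imageState F k).1 (a, F.eval k x))
      (by simp [imageState_apply, rt_ne_zero]) (ket default)
    refine isPlus_of_two_preimages (F.pred k) (F.inv (F.gen r).2 (F.eval k x)) hne _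
      (c := c * rt ^ F.inLen) (fun a x' => (hc (a, x')).trans ?_) hmb
    rw [imageState_apply, mul_ite, mul_zero]
    exact if_congr (and_congr_right fun _ => eq_comm.trans (hpre x')) rfl rfl
  · rw [Set.indicator_of_mem (by simpa using hx)]
    exact failProb_le_one _ _

/-! ### Merging -/

/-- With `u = cos (π/4) = sin (π/4)`, so that `e^{±iπ/4} = u ± ui`, the addition formulas for
`π/8 = π/4 - π/8`. -/
theorem cos_sin_pi_div_eight :
    ∃ u : ℂ, phase 1 = u + u * Complex.I ∧ phase (-1) = u - u * Complex.I ∧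
      u * Real.cos (Real.pi / 8) + u * Real.sin (Real.pi / 8) = Real.cos (Real.pi / 8) ∧
      u * Real.cos (Real.pi / 8) - u * Real.sin (Real.pi / 8) = Real.sin (Real.pi / 8) := by
  have h1 : angle 1 = Real.pi / 4 := by
    rw [angle, show (1 : ZMod 8).val = 1 from rfl]
    push_cast
    ring
  have hcs : Real.sin (Real.pi / 4) = Real.cos (Real.pi / 4) := by
    rw [Real.sin_pi_div_four, Real.cos_pi_div_four]
  have hp : phase 1 = (Real.cos (Real.pi / 4) : ℂ) + Real.cos (Real.pi / 4) * Complex.I := by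
    rw [phase, h1, Complex.exp_mul_I, ← Complex.ofReal_cos, ← Complex.ofReal_sin, hcs]
  refine ⟨Real.cos (Real.pi / 4), hp, ?_, ?_, ?_⟩
  · rw [← exp_neg_angle 1 |>.trans (phase_neg 1).symm, h1, Complex.exp_mul_I, ← Complex.ofReal_cos,
      ← Complex.ofReal_sin, Real.cos_neg, Real.sin_neg, hcs]
    push_cast
    ring
  · have h := Real.cos_sub (Real.pi / 4) (Real.pi / 8)
    rw [hcs, show Real.pi / 4 - Real.pi / 8 = Real.pi / 8 by ring] at h
    exact_mod_cast h.symm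
  · have h := Real.sin_sub (Real.pi / 4) (Real.pi / 8)
    rw [hcs, show Real.pi / 4 - Real.pi / 8 = Real.pi / 8 by ring] at h
    exact_mod_cast h.symm

/-- For both outcomes of the measurement of the ancilla, the merged qubit is the one described by
Alice's angle. -/
theorem bobMerge_isPlus {θ θ' : Bool × Bool} {anc tgt : QState Bool} (ha : IsPlus (phase4 θ) anc)
    (ht : IsPlus (phase4 θ') tgt) {out : Bool × QState Bool}
    (hout : out ∈ (bobMerge anc tgt).support) :
    IsPlus (phase (aliceMerge θ θ' out.1)) out.2 := by
  obtain ⟨d, hd⟩ := measureSnd_support _ hout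
  have h1 : ∀ t a, ((onSnd hadamard).apply (prodState tgt anc)).1 (t, a) =
      tgt.1 t * (rt * (anc.1 false * (1 + sgn a * phase4 θ))) := by
    intro t a
    rw [onSnd_apply, Fintype.sum_bool, hadamard_apply, hadamard_apply]
    change rt * sgn (a && true) * (tgt.1 t * anc.1 true) +
      rt * sgn (a && false) * (tgt.1 t * anc.1 false) = _
    rw [ha]
    cases a <;> simp <;> ring
  have h2 : ∀ t a, (czPair.apply ((onSnd hadamard).apply (prodState tgt anc))).1 (t, a) =
      sgn (t && a) * (tgt.1 t * (rt * (anc.1 false * (1 + sgn a * phase4 θ)))) := by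
    intro t a
    change ((Matrix.diagonal _).mulVec _) (t, a) = _
    rw [Matrix.mulVec_diagonal, h1]
    cases t <;> cases a <;> simp
  obtain ⟨u, hu1, hu2, hc, hs⟩ := cos_sin_pi_div_eight
  have hI := Complex.I_mul_I
  have h3 : ∀ t, out.2.1 t = d * (rt * anc.1 false * tgt.1 t *
      ((rotY (Real.pi / 8)).1 out.1 false * (1 + phase4 θ) +
        (rotY (Real.pi / 8)).1 out.1 true * (sgn t * (1 - phase4 θ)))) := by
    intro t
    rw [hd, onSnd_apply, Fintype.sum_bool, h2, h2]
    cases t <;> simp only [Bool.false_and, Bool.true_and, sgn_false, sgn_true] <;> ring1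
  have hR : ∀ a b, (rotY (Real.pi / 8)).1 a b = if a = b then (Real.cos (Real.pi / 8) : ℂ)
      else if a = true then -(Real.sin (Real.pi / 8) : ℂ) else (Real.sin (Real.pi / 8) : ℂ) :=
    fun _ _ => rfl
  have hp : phase (aliceMerge θ θ' out.1) = phase4 θ' * (if θ.2 = true then
      phase (if θ.1 = true then -1 else 1) * sgn out.1 else sgn θ.1) := by
    rw [aliceMerge, phase_add, phase4]
    congr 1
    split_ifs <;> simp [phase_add, phase_four, phase_zero, *]
  rw [IsPlus, h3, h3, ht, hp, hR, hR, phase4_eq θ]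
  generalize (Real.cos (Real.pi / 8) : ℂ) = c at hc hs
  generalize (Real.sin (Real.pi / 8) : ℂ) = s at hc hs
  obtain ⟨o, -⟩ := out
  obtain ⟨a, b⟩ := θ
  simp only
  -- after removing the common factor, an identity between `e^{±iπ/4}`, `cos (π/8)`, `sin (π/8)`
  suffices h : (if o = false then c else if o = true then -s else s) *
        (1 + sgn a * if b = true then Complex.I else 1) -
      (if o = true then c else if o = true then -s else s) *
        (1 - sgn a * if b = true then Complex.I else 1) =
      (if b = true then phase (if a = true then -1 else 1) * sgn o else sgn a) *
      ((if o = false then c else if o = true then -s else s) *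
        (1 + sgn a * if b = true then Complex.I else 1) +
      (if o = true then c else if o = true then -s else s) *
        (1 - sgn a * if b = true then Complex.I else 1)) by
    simp only [sgn_true, sgn_false]
    linear_combination (d * rt * anc.1 false * phase4 θ' * tgt.1 false) * h
  cases b
  · cases a <;> cases o <;> simp
  · cases a <;> cases o <;> simp [hu1, hu2]
    · linear_combination (-Complex.I - 1) * hc + (1 - Complex.I) * hs - (u * c - u * s) * hI
    · linear_combination (1 - Complex.I) * hc + (1 + Complex.I) * hs - (u * c + u * s) * hI
    · linear_combination (Complex.I - 1) * hc + (1 + Complex.I) * hs - (u * c - u * s) * hI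
    · linear_combination (1 + Complex.I) * hc + (1 - Complex.I) * hs - (u * c + u * s) * hI

/-- 8-states QFactory delivers the state that Alice's angle describes, unless one of the two inputs
is bad. -/
theorem failProb_qfactory8_le (F : TrapdoorFamily lam) (r : Bits lam) :
    failProb (qfactory8 F (F.gen r).1 (F.gen r).2) {out | IsPlus (phase out.1) out.2} ≤
      2 * F.badProb r := by
  have h4 := failProb_bobQFactory4_le F r
  rw [qfactory8, two_mul]
  refine (failProb_bind_le _ _ _ _ (c := F.badProb r) fun a ha => ?_).trans
    (add_le_add le_rfl h4)
  rw [← zero_add (F.badProb r)]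
  refine (failProb_bind_le _ _ _ _ (c := 0) fun b hb => ?_).trans (add_le_add le_rfl h4)
  refine (failProb_eq_zero _ _ fun out hout => ?_).le
  obtain ⟨c, hc, hout⟩ := (PMF.mem_support_bind_iff _ _ _).mp hout
  obtain rfl := (PMF.mem_support_pure_iff _ _).mp hout
  exact bobMerge_isPlus ha hb hc

/-- The average of the failure probabilities over the coins of the key. -/
theorem expect_badProb_le {F : TrapdoorFamily lam} {ε : ℝ} (h : F.TwoRegular ε) :
    expect (PMF.uniformOfFintype (Bits lam)) F.badProb ≤ ENNReal.ofReal ε := by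
  classical
  have hx : ∀ r, F.badProb r = ∑ x, (Fintype.card (Bits F.inLen) : ENNReal)⁻¹ *
      if F.Good r x then 0 else 1 := by
    intro r
    rw [TrapdoorFamily.badProb, failProb, expect_fintype]
    refine Finset.sum_congr rfl fun x _ => ?_
    by_cases h : F.Good r x <;> simp [h]
  have hc : ((Finset.univ.filter fun p : Bits lam × Bits F.inLen => ¬ F.Good p.1 p.2).card :
      ENNReal) = ∑ r, ∑ x, if F.Good r x then 0 else 1 := by
    rw [← Fintype.sum_prod_type' fun r x => if F.Good r x then (0 : ENNReal) else 1,
      Finset.card_filter]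
    push_cast
    refine Finset.sum_congr rfl fun p _ => ?_
    by_cases hp : F.Good p.1 p.2 <;> simp [hp]
  have hN : (0 : ℝ) < Fintype.card (Bits lam × Bits F.inLen) := by
    exact_mod_cast Fintype.card_pos
  have hle : ((Finset.univ.filter fun p : Bits lam × Bits F.inLen => ¬ F.Good p.1 p.2).card :
      ENNReal) ≤ ENNReal.ofReal ε * Fintype.card (Bits lam × Bits F.inLen) := by
    have := ENNReal.ofReal_le_ofReal h
    rwa [ENNReal.ofReal_mul' hN.le, ENNReal.ofReal_natCast, ENNReal.ofReal_natCast] at this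
  simp only [expect_fintype, hx, PMF.uniformOfFintype_apply, ← Finset.mul_sum]
  rw [← hc, ← mul_assoc, ← ENNReal.mul_inv (Or.inl (by simp)) (Or.inl (ENNReal.natCast_ne_top _)),
    ← Nat.cast_mul, ← Fintype.card_prod, mul_comm, ← div_eq_mul_inv]
  exact ENNReal.div_le_of_le_mul hle

/-! ### Adaptive measurements -/

theorem expect_measureQubit {κ : Type} [Fintype κ] [DecidableEq κ] (q : κ)
    (ψ : QState (κ → Bool)) (g : Bool × QState (κ → Bool) → ENNReal) :
    expect (measureQubit q ψ) g =
      ∑ b, (∑ a : κ → Bool, ENNReal.ofReal (‖if a q = b then ψ.1 a else 0‖ ^ 2)) *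
        g (b, normalize (fun a => if a q = b then ψ.1 a else 0) ψ) := by
  rw [measureQubit, expect_bind, expect_fintype]
  simp only [expect_pure, Finset.sum_mul]
  rw [Finset.sum_comm]
  refine Finset.sum_congr rfl fun x _ => ?_
  rw [Finset.sum_eq_single (x q)]
  · rw [if_pos rfl]
    rfl
  · intro b _ hb
    rw [if_neg hb.symm]
    simp
  · simp

/-- A quadratic function of the state after a measurement outcome, weighted with the probability of
that outcome, is the quadratic function of the unnormalized state. -/
theorem weight_mul_normalize {ι : Type} [Fintype ι] (v : ι → ℂ) (fb : QState ι)
    (F : QState ι → ENNReal) (Q : (ι → ℂ) → ENNReal)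
    (hQ : ∀ (c : ℂ) (v : ι → ℂ), Q (fun i => c * v i) = ENNReal.ofReal (‖c‖ ^ 2) * Q v)
    (hF : ∀ χ : QState ι, (∀ i, v i = 0 → χ.1 i = 0) → F χ = Q χ.1) :
    (∑ i, ENNReal.ofReal (‖v i‖ ^ 2)) * F (normalize v fb) = Q v := by
  rw [← ENNReal.ofReal_sum_of_nonneg fun i _ => by positivity]
  by_cases h : ∑ k, ‖v k‖ ^ 2 = 0
  · have hv : v = fun i => 0 * v i := by
      funext i
      have := (Finset.sum_eq_zero_iff_of_nonneg fun i _ => by positivity).mp h i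
        (Finset.mem_univ i)
      simpa using this
    rw [h, hv, hQ]
    simp
  · have hn := normalize_apply h fb
    have h0 : 0 ≤ ∑ k, ‖v k‖ ^ 2 := Finset.sum_nonneg fun i _ => by positivity
    rw [hF _ fun i hi => by rw [hn, hi, mul_zero], funext hn, hQ, ← mul_assoc,
      ← ENNReal.ofReal_mul h0, norm_inv, Complex.norm_real, Real.norm_eq_abs, inv_pow, sq_abs,
      Real.sq_sqrt h0, mul_inv_cancel₀ h, ENNReal.ofReal_one, one_mul]

/-- A single-qubit gate acts on its qubit and fixes the labels of all others. -/
theorem onQubit_apply {κ : Type} [Fintype κ] [DecidableEq κ] (q : κ) (g : Gate Bool)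
    (a b : κ → Bool) :
    (onQubit q g).1 a b = if ∀ u, u ≠ q → a u = b u then g.1 (a q) (b q) else 0 := by
  change ∏ u, (if u = q then g else 1 : Gate Bool).1 (a u) (b u) = _
  split_ifs with h
  · rw [Finset.prod_eq_single q]
    · rw [if_pos rfl]
    · intro u _ hu
      rw [if_neg hu, h u hu]
      simp
    · simp
  · push Not at h
    obtain ⟨u, hu, hab⟩ := h
    refine Finset.prod_eq_zero (Finset.mem_univ u) ?_
    rw [if_neg hu]
    simp [Matrix.one_apply_ne hab]

/-- One step of an adaptive measurement: vertex `v` is measured at an angle that depends on the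
outcomes so far, and the outcome is recorded after adding the bit `r v`. -/
def adaptiveStep {κ : Type} [Fintype κ] [DecidableEq κ] (α : (κ → Bool) → κ → ℝ) (r : κ → Bool)
    (st : QState (κ → Bool) × (κ → Bool)) (v : κ) : PMF (QState (κ → Bool) × (κ → Bool)) := do
  let out ← measureXY v (α st.2 v) st.1
  pure (out.2, Function.update st.2 v (xor out.1 (r v)))

/-- The amplitude of the records `t` on the vertices in `L`: every such vertex contributes the
entry of `H R_z(-α)` at the outcome that leads to the record. -/
def recordAmp {κ : Type} [Fintype κ] [DecidableEq κ] (α : (κ → Bool) → κ → ℝ) (r : κ → Bool)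
    (L : List κ) (t : κ → Bool) (x : (κ → Bool) → ℂ) : ℂ :=
  ∑ a, (L.map fun v => (hadamard * rotZ (-α t v)).1 (xor (t v) (r v)) (a v)).prod * x a

theorem recordAmp_smul {κ : Type} [Fintype κ] [DecidableEq κ] (α : (κ → Bool) → κ → ℝ)
    (r : κ → Bool) (L : List κ) (t : κ → Bool) (c : ℂ) (x : (κ → Bool) → ℂ) :
    recordAmp α r L t (fun a => c * x a) = c * recordAmp α r L t x := by
  rw [recordAmp, recordAmp, Finset.mul_sum]
  exact Finset.sum_congr rfl fun a _ => by ring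

/-- Rotating and projecting one vertex moves its factor out of the amplitude. -/
theorem recordAmp_cons {κ : Type} [Fintype κ] [DecidableEq κ] (α : (κ → Bool) → κ → ℝ)
    (r : κ → Bool) {v : κ} {L : List κ} (hv : v ∉ L) (t : κ → Bool) (ψ : QState (κ → Bool)) :
    recordAmp α r L t (fun a => if a v = xor (t v) (r v) then
      ((onQubit v (hadamard * rotZ (-α t v))).apply ψ).1 a else 0) =
      recordAmp α r (v :: L) t ψ.1 := by
  have h : ∀ a, ((onQubit v (hadamard * rotZ (-α t v))).apply ψ).1 a =
      ∑ a', (onQubit v (hadamard * rotZ (-α t v))).1 a a' * ψ.1 a' := fun _ => rfl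
  have hexp : ∀ a, (L.map fun u => (hadamard * rotZ (-α t u)).1 (xor (t u) (r u)) (a u)).prod *
      (if a v = xor (t v) (r v) then ((onQubit v (hadamard * rotZ (-α t v))).apply ψ).1 a else 0) =
      ∑ a', (if a v = xor (t v) (r v) then
        (L.map fun u => (hadamard * rotZ (-α t u)).1 (xor (t u) (r u)) (a u)).prod *
        ((onQubit v (hadamard * rotZ (-α t v))).1 a a' * ψ.1 a') else 0) := by
    intro a
    split_ifs
    · rw [h, Finset.mul_sum]
    · simp
  simp only [recordAmp, hexp]
  rw [Finset.sum_comm]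
  refine Finset.sum_congr rfl fun a' _ => ?_
  rw [Finset.sum_eq_single (Function.update a' v (xor (t v) (r v)))]
  · have hL : (L.map fun u => (hadamard * rotZ (-α t u)).1 (xor (t u) (r u))
        (Function.update a' v (xor (t v) (r v)) u)) =
        L.map fun u => (hadamard * rotZ (-α t u)).1 (xor (t u) (r u)) (a' u) := by
      refine List.map_congr_left fun u hu => ?_
      rw [Function.update_of_ne (ne_of_mem_of_not_mem hu hv)]
    rw [Function.update_self, if_pos rfl, hL, onQubit_apply, if_pos, Function.update_self,
      List.map_cons, List.prod_cons]
    · ring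
    · intro u hu
      rw [Function.update_of_ne hu]
  · intro a _ ha
    split_ifs with hav
    · rw [onQubit_apply, if_neg]
      · simp
      · intro hcon
        refine ha (funext fun u => ?_)
        by_cases huv : u = v
        · subst huv
          simpa using hav
        · rw [Function.update_of_ne huv, hcon u huv]
    · rfl
  · simp

/-- The records of an adaptive measurement of the vertices in `L`, none of them twice, have the
squared amplitudes as probabilities, provided every angle depends only on earlier outcomes. -/
theorem expect_foldlM_adaptiveStep {κ : Type} [Fintype κ] [DecidableEq κ]
    (α : (κ → Bool) → κ → ℝ) (r : κ → Bool) (rank : κ → ℕ)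
    (hα : ∀ σ τ v, (∀ u, rank u < rank v → σ u = τ u) → α σ v = α τ v)
    (g : (κ → Bool) → ENNReal) (L : List κ) (hnd : L.Nodup)
    (hL : L.Pairwise fun u v => rank u ≤ rank v) (ψ : QState (κ → Bool)) (w σ : κ → Bool)
    (hψ : ∀ a, ψ.1 a ≠ 0 → ∀ v ∉ L, a v = w v) :
    expect (L.foldlM (adaptiveStep α r) (ψ, σ)) (fun st => g st.2) =
      ∑ t, if ∀ v ∉ L, t v = σ v then ENNReal.ofReal (‖recordAmp α r L t ψ.1‖ ^ 2) * g t
        else 0 := by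
  classical
  induction L generalizing ψ w σ with
  | nil =>
    have hsum : ∑ a, ψ.1 a = ψ.1 w := by
      refine Finset.sum_eq_single w (fun a _ ha => ?_) (by simp)
      by_contra h
      exact ha (funext fun v => hψ a h v (by simp))
    have hone : ‖ψ.1 w‖ ^ 2 = 1 := by
      have hw : ∑ a, ‖ψ.1 a‖ ^ 2 = ‖ψ.1 w‖ ^ 2 := by
        refine Finset.sum_eq_single w (fun a _ ha => ?_) (by simp)
        have h0 : ψ.1 a = 0 := by
          by_contra h
          exact ha (funext fun v => hψ a h v (by simp))
        rw [h0, norm_zero, zero_pow two_ne_zero]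
      exact hw.symm.trans ψ.2
    rw [List.foldlM_nil, expect_pure, Finset.sum_eq_single σ]
    · simp [recordAmp, hsum, hone]
    · intro t _ ht
      rw [if_neg]
      intro h
      exact ht (funext fun v => h v (by simp))
    · simp
  | cons v L ih =>
    obtain ⟨hvL, hnd⟩ := List.nodup_cons.mp hnd
    obtain ⟨hvr, hL⟩ := List.pairwise_cons.mp hL
    set φ := (onQubit v (hadamard * rotZ (-α σ v))).apply ψ with hφ
    have hstep : expect (List.foldlM (adaptiveStep α r) (ψ, σ) (v :: L)) (fun st => g st.2) =
        ∑ b, (∑ a : κ → Bool, ENNReal.ofReal (‖if a v = b then φ.1 a else 0‖ ^ 2)) *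
          expect (L.foldlM (adaptiveStep α r)
            (normalize (fun a => if a v = b then φ.1 a else 0) φ,
              Function.update σ v (xor b (r v)))) (fun st => g st.2) := by
      rw [List.foldlM_cons, expect_bind, adaptiveStep, expect_bind, measureXY,
        expect_measureQubit]
      simp only [expect_pure]
      rfl
    -- the recursion for the rest of the list, applied to the unnormalized branch of outcome `b`
    have hbranch : ∀ b, (∑ a : κ → Bool, ENNReal.ofReal (‖if a v = b then φ.1 a else 0‖ ^ 2)) *
          expect (L.foldlM (adaptiveStep α r)
            (normalize (fun a => if a v = b then φ.1 a else 0) φ,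
              Function.update σ v (xor b (r v)))) (fun st => g st.2) =
        ∑ t, if ∀ u ∉ L, t u = Function.update σ v (xor b (r v)) u then
          ENNReal.ofReal (‖recordAmp α r L t fun a => if a v = b then φ.1 a else 0‖ ^ 2) * g t
          else 0 := by
      intro b
      refine weight_mul_normalize (fun a => if a v = b then φ.1 a else 0) φ
        (fun χ => expect (L.foldlM (adaptiveStep α r) (χ, Function.update σ v (xor b (r v))))
          (fun st => g st.2))
        (fun x => ∑ t, if ∀ u ∉ L, t u = Function.update σ v (xor b (r v)) u then
          ENNReal.ofReal (‖recordAmp α r L t x‖ ^ 2) * g t else 0) ?_ ?_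
      · intro c x
        simp only [recordAmp_smul, norm_mul, mul_pow, Finset.mul_sum, mul_ite, mul_zero,
          ENNReal.ofReal_mul (sq_nonneg ‖c‖), mul_assoc]
      · intro χ hχ
        refine ih hnd hL χ (Function.update w v b) _ fun a ha u hu => ?_
        have ha' : a v = b ∧ φ.1 a ≠ 0 := by
          by_contra hcon
          refine ha (hχ a ?_)
          simpa [or_iff_not_imp_left] using hcon
        by_cases huv : u = v
        · subst huv
          simp [ha'.1]
        · rw [Function.update_of_ne huv]
          by_contra hau
          refine ha'.2 (Finset.sum_eq_zero fun a' _ => ?_)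
          change (onQubit v _).1 a a' * ψ.1 a' = 0
          rw [onQubit_apply]
          split_ifs with h
          · by_cases h0 : ψ.1 a' = 0
            · rw [h0, mul_zero]
            · refine absurd ?_ hau
              rw [h u huv]
              exact hψ a' h0 u (by simp [huv, hu])
          · rw [zero_mul]
    rw [hstep, Finset.sum_congr rfl fun b _ => hbranch b, Finset.sum_comm]
    refine Finset.sum_congr rfl fun t _ => ?_
    -- of the two branches only the one that leads to the record `t v` contributes to `t`
    have hiff : ∀ b, (∀ u ∉ L, t u = Function.update σ v (xor b (r v)) u) ↔
        b = xor (t v) (r v) ∧ ∀ u ∉ v :: L, t u = σ u := by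
      intro b
      constructor
      · intro h
        refine ⟨?_, fun u hu => ?_⟩
        · have := h v hvL
          rw [Function.update_self] at this
          rw [this]
          simp
        · have huv : u ≠ v := fun h => hu (by simp [h])
          rw [h u fun h => hu (by simp [h]), Function.update_of_ne huv]
      · rintro ⟨rfl, h⟩ u hu
        by_cases huv : u = v
        · subst huv
          simp
        · rw [Function.update_of_ne huv]
          exact h u (by simp [huv, hu])
    rw [Finset.sum_congr rfl fun b _ => if_congr (hiff b) rfl rfl]
    by_cases ht : ∀ u ∉ v :: L, t u = σ u
    · have hαt : α σ v = α t v := by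
        refine hα σ t v fun u hu => (ht u ?_).symm
        intro hmem
        rcases List.mem_cons.mp hmem with rfl | hmem
        · exact lt_irrefl _ hu
        · exact absurd (hvr u hmem) (not_le.mpr hu)
      rw [if_pos ht, Finset.sum_eq_single (xor (t v) (r v))]
      · rw [if_pos ⟨rfl, ht⟩, hφ, hαt, recordAmp_cons α r hvL]
      · intro b _ hb
        rw [if_neg fun h => hb h.1]
      · simp
    · rw [if_neg ht]
      exact Finset.sum_eq_zero fun b _ => if_neg fun h => ht h.2

/-- The case in which all vertices are measured. -/
theorem expect_foldlM_adaptiveStep_of_forall_mem {κ : Type} [Fintype κ] [DecidableEq κ]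
    (α : (κ → Bool) → κ → ℝ) (r : κ → Bool) (rank : κ → ℕ)
    (hα : ∀ σ τ v, (∀ u, rank u < rank v → σ u = τ u) → α σ v = α τ v)
    (g : (κ → Bool) → ENNReal) (L : List κ) (hnd : L.Nodup)
    (hL : L.Pairwise fun u v => rank u ≤ rank v) (hmem : ∀ v, v ∈ L) (ψ : QState (κ → Bool))
    (σ : κ → Bool) :
    expect (L.foldlM (adaptiveStep α r) (ψ, σ)) (fun st => g st.2) =
      ∑ t, ENNReal.ofReal (‖recordAmp α r L t ψ.1‖ ^ 2) * g t := by
  rw [expect_foldlM_adaptiveStep α r rank hα g L hnd hL ψ σ σ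
    fun a _ v hv => absurd (hmem v) hv]
  exact Finset.sum_congr rfl fun t _ => if_pos fun v hv => absurd (hmem v) hv

/-! ### Entries of the rotated Hadamard gate -/

/-- The factor of a basis state of one qubit under `diag(1, w)`. -/
def pw (w : ℂ) (b : Bool) : ℂ := if b = true then w else 1

theorem pw_mul (w z : ℂ) (b : Bool) : pw (w * z) b = pw w b * pw z b := by
  cases b <;> simp [pw]

theorem pw_sgn (c b : Bool) : pw (sgn c) b = sgn (c && b) := by
  cases b <;> cases c <;> simp [pw]

theorem norm_pw {w : ℂ} (hw : ‖w‖ = 1) (b : Bool) : ‖pw w b‖ = 1 := by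
  cases b <;> simp [pw, hw]

theorem hadamard_mul_rotZ_apply (δ : ZMod 8) (b a : Bool) :
    (hadamard * rotZ (-angle δ)).1 b a = rt * (sgn (b && a) * pw (phase δ)⁻¹ a) := by
  have he := exp_neg_angle δ
  rw [Complex.ofReal_neg, neg_mul] at he
  simp only [Submonoid.coe_mul, Matrix.mul_apply, Fintype.sum_bool, hadamard_apply, rotZ, diagGate,
    Matrix.diagonal_apply]
  cases a <;> simp [pw, he, mul_assoc]

/-! ### Controlled-`Z` gates along the edges of a graph -/

open Classical in
/-- The sign of a basis state under the controlled-`Z` gates along the edges of a graph. -/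
def czSign {κ : Type} [Fintype κ] [DecidableEq κ] (G : SimpleGraph κ) (a : κ → Bool) : ℂ :=
  (-1) ^ (G.edgeFinset.filter fun e => ∀ v ∈ e, a v = true).card

theorem czGate_apply {κ : Type} [Fintype κ] [DecidableEq κ] (G : SimpleGraph κ)
    (ψ : QState (κ → Bool)) (a : κ → Bool) :
    ((czGate G).apply ψ).1 a = czSign G a * ψ.1 a :=
  Matrix.mulVec_diagonal _ _ _

open Classical in
/-- With every edge counted once, in the direction given by `D`, the sign is a product over pairs of
vertices. -/
theorem czSign_eq_prod {κ : Type} [Fintype κ] [DecidableEq κ] (G : SimpleGraph κ)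
    (D : κ → κ → Prop) (hD : ∀ u v, D u v → ¬ D v u) (hG : ∀ u v, G.Adj u v ↔ D u v ∨ D v u)
    (a : κ → Bool) :
    czSign G a = ∏ u, ∏ v, if D u v then sgn (a u && a v) else 1 := by
  have hcard : (Finset.univ.filter fun p : κ × κ => D p.1 p.2 ∧ a p.1 = true ∧ a p.2 = true).card =
      (G.edgeFinset.filter fun e => ∀ v ∈ e, a v = true).card := by
    refine Finset.card_bij (fun p _ => s(p.1, p.2)) ?_ ?_ ?_
    · rintro ⟨u, v⟩ h
      simp only [Finset.mem_filter, Finset.mem_univ, true_and] at h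
      simp [hG, h.1, h.2.1, h.2.2]
    · rintro ⟨u, v⟩ h ⟨u', v'⟩ h' heq
      simp only [Finset.mem_filter, Finset.mem_univ, true_and] at h h'
      rcases Sym2.eq_iff.mp heq with ⟨h1, h2⟩ | ⟨h1, h2⟩
      · exact Prod.ext h1 h2
      · simp only at h1 h2
        subst h1 h2
        exact absurd h'.1 (hD _ _ h.1)
    · intro e he
      induction e using Sym2.ind with
      | _ u v =>
        simp only [Finset.mem_filter, SimpleGraph.mem_edgeFinset, SimpleGraph.mem_edgeSet,
          Sym2.mem_iff, forall_eq_or_imp, forall_eq, hG] at he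
        rcases he.1 with h | h
        · exact ⟨(u, v), by simpa using ⟨h, he.2⟩, rfl⟩
        · exact ⟨(v, u), by simpa using ⟨h, he.2.2, he.2.1⟩, Sym2.eq_swap⟩
  rw [czSign, ← hcard, ← Finset.prod_const, Finset.prod_filter, Fintype.prod_prod_type]
  refine Finset.prod_congr rfl fun u _ => Finset.prod_congr rfl fun v _ => ?_
  by_cases h : D u v <;> cases a u <;> cases a v <;> simp [h]

open Classical in
/-- Flipping the qubits with `s u = 1` changes the sign at every vertex by the parity of `s` over the
neighbours. -/
theorem czSign_bxor {κ : Type} [Fintype κ] [DecidableEq κ] (G : SimpleGraph κ)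
    (D : κ → κ → Prop) (hD : ∀ u v, D u v → ¬ D v u) (hG : ∀ u v, G.Adj u v ↔ D u v ∨ D v u)
    (a s : κ → Bool) :
    czSign G (bxor a s) = czSign G a * czSign G s *
      ∏ u, pw (∏ w, if G.Adj w u then sgn (s w) else 1) (a u) := by
  have hpw : ∀ u, pw (∏ w, if G.Adj w u then sgn (s w) else 1) (a u) =
      (∏ w, if D u w then sgn (a u && s w) else 1) *
        ∏ w, if D w u then sgn (s w && a u) else 1 := by
    intro u
    rw [← Finset.prod_mul_distrib]
    cases hau : a u
    · simp [pw]
    · simp only [pw, if_true, hG, Bool.true_and, Bool.and_true]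
      refine Finset.prod_congr rfl fun w _ => ?_
      by_cases h1 : D u w
      · simp [h1, hD u w h1]
      · by_cases h2 : D w u <;> simp [h1, h2]
  rw [Finset.prod_congr rfl fun u _ => hpw u, Finset.prod_mul_distrib,
    Finset.prod_comm (f := fun u w => if D w u then sgn (s w && a u) else 1)]
  simp only [czSign_eq_prod G D hD hG, ← Finset.prod_mul_distrib]
  refine Finset.prod_congr rfl fun u _ => Finset.prod_congr rfl fun v _ => ?_
  by_cases h : D u v
  · simp only [h, if_true, bxor]
    cases a u <;> cases a v <;> cases s u <;> cases s v <;> simp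
  · simp [h]

theorem norm_czSign {κ : Type} [Fintype κ] [DecidableEq κ] (G : SimpleGraph κ) (a : κ → Bool) :
    ‖czSign G a‖ = 1 := by
  simp [czSign]

/-! ### The circuit as a sum over paths -/

/-- The amplitudes after a sequence of gates are sums over the intermediate basis states. -/
theorem prod_gates_apply {ι : Type} [Fintype ι] [DecidableEq ι] :
    ∀ (k : ℕ) (M : Fin k → Gate ι) (ψ : QState ι) (b : ι),
      (((List.finRange k).reverse.map M).prod.apply ψ).1 b =
        ∑ p : Fin k → ι, (∏ j, (M j).1 ((Fin.snoc p b : Fin (k + 1) → ι) j.succ) (p j)) *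
          ψ.1 ((Fin.snoc p b : Fin (k + 1) → ι) 0)
  | 0, M, ψ, b => by
    have h : ((1 : Gate ι).apply ψ).1 = ψ.1 := Matrix.one_mulVec _
    simp only [List.finRange_zero, List.reverse_nil, List.map_nil, List.prod_nil, h]
    rw [Fintype.sum_unique]
    simp [Fin.snoc]
  | k + 1, M, ψ, b => by
    have hstep : (((List.finRange (k + 1)).reverse.map M).prod.apply ψ).1 b =
        ∑ a, (M (Fin.last k)).1 b a *
          (((List.finRange k).reverse.map fun j => M j.castSucc).prod.apply ψ).1 a := by
      rw [List.finRange_succ_last]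
      simp only [List.reverse_append, List.reverse_cons, List.reverse_nil, List.nil_append,
        List.map_append, List.map_cons, List.map_nil, List.prod_append, List.prod_cons,
        List.prod_nil, mul_one, ← List.map_reverse, List.map_map]
      change (((M (Fin.last k)).1 * _).mulVec ψ.1) b = _
      rw [← Matrix.mulVec_mulVec]
      rfl
    rw [hstep, ← Equiv.sum_comp (Fin.snocEquiv fun _ => ι), Fintype.sum_prod_type]
    refine Finset.sum_congr rfl fun a _ => ?_
    rw [prod_gates_apply k, Finset.mul_sum]
    refine Finset.sum_congr rfl fun p _ => ?_
    change _ = (∏ j, (M j).1 ((Fin.snoc (Fin.snoc p a : Fin (k + 1) → ι) b :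
      Fin (k + 2) → ι) j.succ) ((Fin.snoc p a : Fin (k + 1) → ι) j)) *
      ψ.1 ((Fin.snoc (Fin.snoc p a : Fin (k + 1) → ι) b : Fin (k + 2) → ι) 0)
    have h0 : (Fin.snoc (Fin.snoc p a : Fin (k + 1) → ι) b : Fin (k + 2) → ι) 0 =
        (Fin.snoc p a : Fin (k + 1) → ι) 0 :=
      Fin.snoc_castSucc (α := fun _ => ι) b (Fin.snoc p a : Fin (k + 1) → ι) 0
    have hs : ∀ j : Fin k, (Fin.snoc (Fin.snoc p a : Fin (k + 1) → ι) b : Fin (k + 2) → ι)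
        j.castSucc.succ = (Fin.snoc p a : Fin (k + 1) → ι) j.succ := fun j =>
      Fin.snoc_castSucc (α := fun _ => ι) b (Fin.snoc p a : Fin (k + 1) → ι) j.succ
    have hl : (Fin.snoc (Fin.snoc p a : Fin (k + 1) → ι) b : Fin (k + 2) → ι)
        (Fin.last k).succ = b := Fin.snoc_last (α := fun _ => ι) b (Fin.snoc p a : Fin (k + 1) → ι)
    rw [Fin.prod_univ_castSucc, h0, hl, Fin.snoc_last]
    simp only [hs, Fin.snoc_castSucc]
    ring

/-- The orientation of the resource graph to the right and downwards. -/
def Resource.dir (R : Resource) {n m : ℕ} (u v : Vertex n m) : Prop :=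
  (u.1 = v.1 ∧ u.2.val + 1 = v.2.val) ∨
    (u.2 = v.2 ∧ u.1.val + 1 = v.1.val ∧ R.bond u.1.val u.2.val)

theorem Resource.dir_asymm (R : Resource) {n m : ℕ} (u v : Vertex n m) (h : R.dir u v) :
    ¬ R.dir v u := by
  obtain ⟨i, j⟩ := u
  obtain ⟨i', j'⟩ := v
  simp only [Resource.dir, Fin.ext_iff] at h ⊢
  omega

theorem Resource.graph_adj (R : Resource) {n m : ℕ} (u v : Vertex n m) :
    (R.graph n m).Adj u v ↔ R.dir u v ∨ R.dir v u := by
  refine (SimpleGraph.fromRel_adj _ u v).trans (and_iff_right_of_imp fun h huv => ?_)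
  subst huv
  exact R.dir_asymm u u (h.elim id id) (h.elim id id)

/-- The sign of a labelling of the grid splits into the horizontal edges and the columns. -/
theorem czSign_graph (R : Resource) {n m : ℕ} (a : Vertex n m → Bool) :
    czSign (R.graph n m) a =
      (∏ j : Fin m, ∏ i, sgn (a (i, j.castSucc) && a (i, j.succ))) *
        ∏ j, czSign ((R.graph n m).comap fun i => (i, j)) fun i => a (i, j) := by
  classical
  have hcol : ∀ j : Fin (m + 1), czSign ((R.graph n m).comap fun i => (i, j)) (fun i => a (i, j)) =
      ∏ i, ∏ i', if R.dir (i, j) (i', j) then sgn (a (i, j) && a (i', j)) else 1 := fun j =>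
    czSign_eq_prod _ (fun i i' => R.dir (i, j) (i', j)) (fun i i' => R.dir_asymm _ _)
      (fun i i' => R.graph_adj _ _) _
  -- from a vertex `(i, j)`, separate the edge to the right from the one in the same column
  have hin : ∀ i j i', (∏ j', if R.dir (i, j) (i', j') then sgn (a (i, j) && a (i', j')) else 1) =
      (∏ j', if i' = i ∧ j.val + 1 = j'.val then sgn (a (i, j) && a (i, j')) else 1) *
        if R.dir (i, j) (i', j) then sgn (a (i, j) && a (i', j)) else 1 := by
    intro i j i'
    rw [← Fintype.prod_ite_eq' j fun j' => if R.dir (i, j) (i', j') then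
      sgn (a (i, j) && a (i', j')) else 1, ← Finset.prod_mul_distrib]
    refine Finset.prod_congr rfl fun j' _ => ?_
    by_cases hj : j' = j
    · subst hj
      simp
    · have hd : R.dir (i, j) (i', j') ↔ i' = i ∧ j.val + 1 = j'.val := by
        simp [Resource.dir, eq_comm (a := i), Ne.symm hj]
      rw [if_neg hj, mul_one]
      refine ite_congr (propext hd) (fun h => ?_) fun _ => rfl
      rw [h.1]
  have hhor : ∀ i j, (∏ i' : Fin n, ∏ j' : Fin (m + 1),
      if i' = i ∧ j.val + 1 = j'.val then sgn (a (i, j) && a (i, j')) else 1) =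
      ∏ j' : Fin (m + 1), if j.val + 1 = j'.val then sgn (a (i, j) && a (i, j')) else 1 := by
    intro i j
    rw [Finset.prod_eq_single i]
    · simp
    · intro i' _ hi
      simp [hi]
    · simp
  have hrow : ∀ i, (∏ j : Fin (m + 1), ∏ j' : Fin (m + 1),
      if j.val + 1 = j'.val then sgn (a (i, j) && a (i, j')) else 1) =
      ∏ j : Fin m, sgn (a (i, j.castSucc) && a (i, j.succ)) := by
    intro i
    rw [Fin.prod_univ_castSucc]
    have hlast : (∏ j' : Fin (m + 1), if (Fin.last m).val + 1 = j'.val then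
        sgn (a (i, Fin.last m) && a (i, j')) else 1) = 1 := by
      refine Finset.prod_eq_one fun j' _ => if_neg ?_
      have := j'.isLt
      simp only [Fin.val_last]
      omega
    rw [hlast, mul_one]
    refine Finset.prod_congr rfl fun j _ => ?_
    rw [Finset.prod_eq_single j.succ]
    · simp
    · intro j' _ hj
      refine if_neg fun h => hj (Fin.ext ?_)
      simpa using h.symm
    · simp
  rw [czSign_eq_prod _ _ R.dir_asymm R.graph_adj, Fintype.prod_prod_type]
  simp only [hcol, Fintype.prod_prod_type, hin, Finset.prod_mul_distrib, hhor, hrow]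
  congr 1
  · rw [Finset.prod_comm]
  · rw [Finset.prod_comm]

/-- The sum over all labellings of the grid that gives the amplitude of the circuit at `b`. -/
def pathSum (R : Resource) {n m : ℕ} (Φ : Fin n → Fin (m + 1) → ZMod 8) (ψ : QState (Bits n))
    (b : Bits n) : ℂ :=
  ∑ a : Vertex n m → Bool, (∏ v, pw (phase (Φ v.1 v.2))⁻¹ (a v)) *
    (∏ i, sgn (b i && a (i, Fin.last m))) * czSign (R.graph n m) a * ψ.1 fun i => a (i, 0)

theorem layerGate_apply (R : Resource) {n m : ℕ} (Φ : Fin n → Fin (m + 1) → ZMod 8)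
    (j : Fin (m + 1)) (b a : Bits n) :
    (layerGate R Φ j).1 b a = rt ^ n * (∏ i, sgn (b i && a i)) *
      (∏ i, pw (phase (Φ i j))⁻¹ (a i)) *
      czSign ((R.graph n m).comap fun i => (i, j)) a := by
  change ((tensorGate fun i => hadamard * rotZ (-angle (Φ i j))).1 *
    Matrix.diagonal (czSign ((R.graph n m).comap fun i => (i, j)))) b a = _
  rw [Matrix.mul_diagonal]
  congr 1
  change ∏ i, (hadamard * rotZ (-angle (Φ i j))).1 (b i) (a i) = _
  simp only [hadamard_mul_rotZ_apply, Finset.prod_mul_distrib, Finset.prod_const,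
    Finset.card_univ, Fintype.card_fin, mul_assoc]

theorem encodedUnitary_apply (R : Resource) {n m : ℕ} (Φ : Fin n → Fin (m + 1) → ZMod 8)
    (ψ : QState (Bits n)) (b : Bits n) :
    ((encodedUnitary R Φ).apply ψ).1 b = rt ^ (n * (m + 1)) * pathSum R Φ ψ b := by
  -- a path, one label of all rows per column, is a labelling of the grid
  let e : (Fin (m + 1) → Bits n) ≃ (Vertex n m → Bool) :=
    { toFun := fun p v => p v.2 v.1
      invFun := fun a j i => a (i, j)
      left_inv := fun _ => rfl
      right_inv := fun _ => rfl }
  rw [encodedUnitary, prod_gates_apply, pathSum, Finset.mul_sum, ← Equiv.sum_comp e]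
  refine Finset.sum_congr rfl fun p _ => ?_
  have h0 : (Fin.snoc p b : Fin (m + 2) → Bits n) 0 = p 0 :=
    Fin.snoc_castSucc (α := fun _ => Bits n) b p 0
  have hs : ∀ j : Fin m, (Fin.snoc p b : Fin (m + 2) → Bits n) j.castSucc.succ = p j.succ :=
    fun j => Fin.snoc_castSucc (α := fun _ => Bits n) b p j.succ
  have hl : (Fin.snoc p b : Fin (m + 2) → Bits n) (Fin.last m).succ = b :=
    Fin.snoc_last (α := fun _ => Bits n) b p
  have he : ∀ i j, e p (i, j) = p j i := fun _ _ => rfl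
  simp only [layerGate_apply, Finset.prod_mul_distrib, h0, czSign_graph, he,
    Fintype.prod_prod_type, Finset.prod_const, Finset.card_univ, Fintype.card_fin, ← pow_mul]
  rw [Fin.prod_univ_castSucc (f := fun j : Fin (m + 1) => ∏ i,
    sgn ((Fin.snoc p b : Fin (m + 2) → Bits n) j.succ i && p j i)), hl,
    Finset.prod_comm (f := fun (i : Fin n) (j : Fin (m + 1)) => pw (phase (Φ i j))⁻¹ (p j i))]
  simp only [hs, Bool.and_comm (p (Fin.succ _) _)]
  ring

/-! ### Dependencies along the flow -/

theorem xDep_congr {n m : ℕ} {σ τ : Vertex n m → Bool} {v : Vertex n m}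
    (h : ∀ u, u.2.val < v.2.val → σ u = τ u) : xDep σ v = xDep τ v := by
  classical
  refine congrArg (fun s : Finset (Vertex n m) => decide (Odd s.card))
    (Finset.filter_congr fun u _ => and_congr_left fun hu => ?_)
  rw [h u (by have := hu.2; omega)]

/-- Where a vertex contributes to `s^Z`, it lies in an earlier column. -/
theorem col_lt_of_zDep (R : Resource) {n m : ℕ} {u v w : Vertex n m} (huv : u ≠ v)
    (hu : IsFlow u w) (hw : (R.graph n m).Adj w v) : u.2.val < v.2.val := by
  obtain ⟨i, j⟩ := u
  obtain ⟨i', j'⟩ := v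
  obtain ⟨i'', j''⟩ := w
  rw [R.graph_adj] at hw
  simp only [IsFlow, Resource.dir, ne_eq, Prod.mk.injEq, Fin.ext_iff] at huv hu hw ⊢
  omega

theorem zDep_congr (R : Resource) {n m : ℕ} {σ τ : Vertex n m → Bool} {v : Vertex n m}
    (h : ∀ u, u.2.val < v.2.val → σ u = τ u) : zDep R σ v = zDep R τ v := by
  classical
  refine congrArg (fun s : Finset (Vertex n m) => decide (Odd s.card))
    (Finset.filter_congr fun u _ => and_congr_left fun hu => ?_)
  obtain ⟨huv, w, hf, hw⟩ := hu
  rw [h u (col_lt_of_zDep R huv hf hw)]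

theorem xDep_first_column {n m : ℕ} (t : Vertex n m → Bool) (i : Fin n) :
    xDep t (i, 0) = false := by
  have h : ∀ u : Vertex n m, ¬ IsFlow u (i, 0) := fun u hu => by simpa using hu.2
  simp [xDep, h]

theorem exists_flow_adj_iff (R : Resource) {n m : ℕ} (v : Vertex n m) :
    (∃ w, IsFlow v w ∧ (R.graph n m).Adj w v) ↔ v.2 ≠ Fin.last m := by
  constructor
  · rintro ⟨w, hw, -⟩ hv
    have h1 := hw.2
    have h2 := w.2.isLt
    rw [hv, Fin.val_last] at h1
    omega
  · intro hv
    have hlt : v.2.val + 1 < m + 1 := by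
      have h1 := v.2.isLt
      have h2 : v.2.val ≠ m := fun h => hv (Fin.ext h)
      omega
    have hf : IsFlow v (v.1, ⟨v.2.val + 1, hlt⟩) := ⟨rfl, rfl⟩
    exact ⟨_, hf, (R.graph_adj _ _).mpr (Or.inr (Or.inl hf))⟩

open Classical in
/-- The flow condition: at every vertex `v` the parity of `s^X` over the neighbours of `v` cancels
`s^Z` and, outside the last column, the outcome at `v` itself. -/
theorem sgn_flow (R : Resource) {n m : ℕ} (t : Vertex n m → Bool) (v : Vertex n m) :
    sgn (t v) * sgn (zDep R t v) *
        (∏ w, if (R.graph n m).Adj w v then sgn (xDep t w) else 1) =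
      sgn (t v && decide (v.2 = Fin.last m)) := by
  have hx : ∀ w, sgn (xDep t w) = ∏ u, sgn (decide (t u = true ∧ IsFlow u w)) := by
    intro w
    rw [xDep, sgn_decide_odd_card]
  have hz : sgn (zDep R t v) = ∏ u, sgn (decide (t u = true ∧ u ≠ v ∧
      ∃ w, IsFlow u w ∧ (R.graph n m).Adj w v)) := by
    rw [zDep, sgn_decide_odd_card]
  -- every `u` has at most one flow image, so it counts once if that image is a neighbour of `v`
  have hu : ∀ u, (∏ w, if (R.graph n m).Adj w v then
      sgn (decide (t u = true ∧ IsFlow u w)) else 1) =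
      sgn (decide (t u = true ∧ ∃ w, IsFlow u w ∧ (R.graph n m).Adj w v)) := by
    intro u
    by_cases h : ∃ w, IsFlow u w ∧ (R.graph n m).Adj w v
    · obtain ⟨w, hw, hadj⟩ := h
      rw [Finset.prod_eq_single w]
      · have : ∃ w, IsFlow u w ∧ (R.graph n m).Adj w v := ⟨w, hw, hadj⟩
        simp [hw, hadj, this]
      · intro w' _ hne
        have : ¬ IsFlow u w' := fun h' =>
          hne (Prod.ext (h'.1.symm.trans hw.1) (Fin.ext (h'.2.symm.trans hw.2)))
        simp [this]
      · simp
    · rw [Finset.prod_eq_one]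
      · simp [h]
      · intro w _
        split_ifs with hadj
        · have : ¬ IsFlow u w := fun h' => h ⟨w, h', hadj⟩
          simp [this]
        · rfl
  have hprod : (∏ w, if (R.graph n m).Adj w v then sgn (xDep t w) else 1) =
      ∏ u, sgn (decide (t u = true ∧ ∃ w, IsFlow u w ∧ (R.graph n m).Adj w v)) := by
    rw [← Finset.prod_congr rfl fun u _ => hu u, Finset.prod_comm]
    refine Finset.prod_congr rfl fun w _ => ?_
    split_ifs
    · exact hx w
    · simp
  -- all `u ≠ v` occur in `s^Z` as well and cancel; `u = v` remains
  have hall : sgn (zDep R t v) *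
      (∏ w, if (R.graph n m).Adj w v then sgn (xDep t w) else 1) =
      sgn (decide (t v = true ∧ v.2 ≠ Fin.last m)) := by
    rw [hz, hprod, ← Finset.prod_mul_distrib, Finset.prod_eq_single v]
    · simp [exists_flow_adj_iff, -Prod.exists]
    · intro u _ hne
      simp only [ne_eq, hne, not_false_eq_true, true_and]
      exact sgn_mul_self _
    · simp
  rw [mul_assoc, hall]
  cases t v <;> by_cases hl : v.2 = Fin.last m <;> simp [hl]

theorem inv_phase_adaptedAngle (φ : ZMod 8) (sX sZ : Bool) :
    (phase (adaptedAngle φ sX sZ))⁻¹ = (if sX = true then phase φ else (phase φ)⁻¹) * sgn sZ := by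
  rw [adaptedAngle, phase_add, phase_ite_four, mul_inv]
  cases sX <;> cases sZ <;> simp [phase_neg]

/-- The sum over labellings in the amplitude of the decoded outcomes `t`. -/
def adaptedSum (R : Resource) {n m : ℕ} (Φ : Fin n → Fin (m + 1) → ZMod 8) (ψ : QState (Bits n))
    (t : Vertex n m → Bool) : ℂ :=
  ∑ a : Vertex n m → Bool, (∏ v, sgn (t v && a v) *
    pw (phase (adaptedAngle (Φ v.1 v.2) (xDep t v) (zDep R t v)))⁻¹ (a v)) *
    czSign (R.graph n m) a * ψ.1 fun i => a (i, 0)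

/-- The substitution `a ↦ a ⊕ s^X` turns the sum for the outcomes `t` into the one for the circuit,
up to a factor of modulus one. -/
theorem norm_adaptedSum (R : Resource) {n m : ℕ} (Φ : Fin n → Fin (m + 1) → ZMod 8)
    (ψ : QState (Bits n)) (t : Vertex n m → Bool) :
    ‖adaptedSum R Φ ψ t‖ = ‖pathSum R Φ ψ fun i => t (i, Fin.last m)‖ := by
  classical
  set s : Vertex n m → Bool := fun v => xDep t v with hs
  let C : ℂ := (∏ v, sgn (t v && s v) * pw (sgn (zDep R t v)) (s v) *
    pw (phase (Φ v.1 v.2)) (s v)) * czSign (R.graph n m) s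
  have hC : ‖C‖ = 1 := by
    simp only [C, norm_mul, norm_prod, norm_sgn, norm_czSign, norm_pw (norm_sgn _),
      norm_pw (norm_phase _), mul_one, Finset.prod_const_one]
  suffices h : adaptedSum R Φ ψ t = C * pathSum R Φ ψ fun i => t (i, Fin.last m) by
    rw [h, norm_mul, hC, one_mul]
  let e : (Vertex n m → Bool) ≃ (Vertex n m → Bool) :=
    Function.Involutive.toPerm (fun a => bxor a s) fun a => by
      funext v
      simp [bxor]
  rw [adaptedSum, pathSum, ← Equiv.sum_comp e, Finset.mul_sum]
  refine Finset.sum_congr rfl fun a _ => ?_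
  have he : e a = bxor a s := rfl
  have hvertex : ∀ v, sgn (t v && bxor a s v) *
      pw (phase (adaptedAngle (Φ v.1 v.2) (xDep t v) (zDep R t v)))⁻¹ (bxor a s v) =
      (sgn (t v && s v) * pw (sgn (zDep R t v)) (s v) * pw (phase (Φ v.1 v.2)) (s v)) *
        (pw (phase (Φ v.1 v.2))⁻¹ (a v) * pw (sgn (t v) * sgn (zDep R t v)) (a v)) := by
    intro v
    have h0 := phase_ne_zero (Φ v.1 v.2)
    rw [inv_phase_adaptedAngle, show xDep t v = s v from rfl, bxor]
    cases t v <;> cases zDep R t v <;> cases s v <;> cases a v <;> simp [pw, h0]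
  have hlast : (∏ v : Vertex n m, pw (sgn (t v && decide (v.2 = Fin.last m))) (a v)) =
      ∏ i, sgn (t (i, Fin.last m) && a (i, Fin.last m)) := by
    rw [Fintype.prod_prod_type]
    refine Finset.prod_congr rfl fun i _ => ?_
    rw [Finset.prod_eq_single (Fin.last m)]
    · simp [pw_sgn]
    · intro j _ hj
      simp [hj, pw]
    · simp
  have hflow : ∀ v, pw (sgn (t v) * sgn (zDep R t v)) (a v) *
      pw (∏ w, if (R.graph n m).Adj w v then sgn (s w) else 1) (a v) =
      pw (sgn (t v && decide (v.2 = Fin.last m))) (a v) := by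
    intro v
    rw [← pw_mul, sgn_flow]
  have hfirst : (fun i : Fin n => bxor a s (i, 0)) = fun i => a (i, 0) := by
    funext i
    simp [bxor, hs, xDep_first_column]
  rw [he, Finset.prod_congr rfl fun v _ => hvertex v, Finset.prod_mul_distrib,
    Finset.prod_mul_distrib (f := fun v => pw (phase (Φ v.1 v.2))⁻¹ (a v)),
    czSign_bxor _ _ R.dir_asymm R.graph_adj, hfirst, ← hlast,
    ← Finset.prod_congr rfl fun v _ => hflow v]
  simp only [Finset.prod_mul_distrib, C]
  ring

/-! ### The measurement pattern -/

/-- Remotely prepared qubits with the angles `θ` amount to rotations of `|+⟩` states; the angle `0`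
in the first column leaves Bob's input unrotated. -/
theorem gridState_apply_of_isPlus {n m : ℕ} (ψ : QState (Bits n))
    (q : Fin n → Fin m → QState Bool) (θ : Fin n → Fin (m + 1) → ZMod 8) (hθ : ∀ i, θ i 0 = 0)
    (hq : ∀ i j, IsPlus (phase (θ i j.succ)) (q i j)) (a : Vertex n m → Bool) :
    (gridState ψ q).1 a = (∏ i, ∏ j, (q i j).1 false) *
      (∏ v, pw (phase (θ v.1 v.2)) (a v)) * ψ.1 fun i => a (i, 0) := by
  have h1 : ∀ i j b, (q i j).1 b = (q i j).1 false * pw (phase (θ i j.succ)) b := by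
    intro i j b
    cases b
    · simp [pw]
    · rw [hq i j]
      simp [pw, mul_comm]
  have h2 : (∏ v : Vertex n m, pw (phase (θ v.1 v.2)) (a v)) =
      ∏ i, ∏ j : Fin m, pw (phase (θ i j.succ)) (a (i, j.succ)) := by
    rw [Fintype.prod_prod_type]
    refine Finset.prod_congr rfl fun i _ => ?_
    rw [Fin.prod_univ_succ]
    simp [hθ, phase_zero, pw]
  change (ψ.1 fun i => a (i, 0)) * ∏ i, ∏ j, (q i j).1 (a (i, j.succ)) = _
  rw [Finset.prod_congr rfl fun i _ => Finset.prod_congr rfl fun j _ => h1 i j (a (i, j.succ)), h2]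
  simp only [Finset.prod_mul_distrib]
  ring

/-- The normalization of a state `(|0⟩ + w|1⟩)/√2`. -/
theorem norm_sq_of_isPlus {w : ℂ} (hw : ‖w‖ = 1) {q : QState Bool} (hq : IsPlus w q) :
    ‖q.1 false‖ ^ 2 = 1 / 2 := by
  have h := q.2
  rw [Fintype.sum_bool] at h
  rw [hq, norm_mul, hw, one_mul] at h
  linarith

/-- The angle at which Bob measures. -/
def bobAngle (R : Resource) {n m : ℕ} (Φ θ : Fin n → Fin (m + 1) → ZMod 8)
    (r : Fin n → Fin (m + 1) → Bool) (σ : Vertex n m → Bool) (v : Vertex n m) : ZMod 8 :=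
  adaptedAngle (Φ v.1 v.2) (xDep σ v) (zDep R σ v) + θ v.1 v.2 +
    (if r v.1 v.2 = true then 4 else 0)

theorem schedule_nodup (n m : ℕ) : (schedule n m).Nodup := by
  refine List.nodup_flatMap.mpr ⟨fun j _ => ?_, ?_⟩
  · exact (List.nodup_finRange n).map fun i i' h => (Prod.mk.inj h).1
  · refine (List.nodup_finRange (m + 1)).imp fun {j j'} hj => ?_
    intro v hv hv'
    obtain ⟨i, -, rfl⟩ := List.mem_map.mp hv
    obtain ⟨i', -, h⟩ := List.mem_map.mp hv'
    exact hj (Prod.mk.inj h).2.symm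

theorem mem_schedule {n m : ℕ} (v : Vertex n m) : v ∈ schedule n m := by
  simp only [schedule, List.mem_flatMap, List.mem_finRange, List.mem_map, true_and]
  exact ⟨v.2, v.1, rfl⟩

theorem schedule_sorted (n m : ℕ) :
    (schedule n m).Pairwise fun u v => u.2.val ≤ v.2.val := by
  refine List.pairwise_flatMap.mpr ⟨fun j _ => ?_, ?_⟩
  · exact List.pairwise_map.mpr (List.pairwise_of_forall fun _ _ => le_rfl)
  · refine (List.pairwise_lt_finRange (m + 1)).imp fun {j j'} hj => ?_
    intro u hu v hv
    obtain ⟨i, -, rfl⟩ := List.mem_map.mp hu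
    obtain ⟨i', -, rfl⟩ := List.mem_map.mp hv
    exact hj.le

/-- Alice's mask `r` and the remote angle `θ` cancel, so every run of outcomes has, up to a power of
`1/2` and with the outcomes of the last column as the result, the probability of the circuit. -/
theorem norm_sq_recordAmp (R : Resource) {n m : ℕ} (Φ θ : Fin n → Fin (m + 1) → ZMod 8)
    (r : Fin n → Fin (m + 1) → Bool) (ψ : QState (Bits n)) (q : Fin n → Fin m → QState Bool)
    (hθ : ∀ i, θ i 0 = 0) (hq : ∀ i j, IsPlus (phase (θ i j.succ)) (q i j))
    (t : Vertex n m → Bool) :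
    ‖recordAmp (fun σ v => angle (bobAngle R Φ θ r σ v)) (fun v => r v.1 v.2) (schedule n m) t
        ((czGate (R.graph n m)).apply (gridState ψ q)).1‖ ^ 2 =
      (1 / 2) ^ (n * m) * ‖((encodedUnitary R Φ).apply ψ).1 fun i => t (i, Fin.last m)‖ ^ 2 := by
  have hlist : ∀ f : Vertex n m → ℂ, ((schedule n m).map f).prod = ∏ v, f v := by
    intro f
    rw [← List.prod_toFinset f (schedule_nodup n m)]
    congr 1
    ext v
    simp [mem_schedule]
  have hvertex : ∀ (a : Vertex n m → Bool) v, sgn (xor (t v) (r v.1 v.2) && a v) *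
      pw (phase (bobAngle R Φ θ r t v))⁻¹ (a v) * pw (phase (θ v.1 v.2)) (a v) =
      sgn (t v && a v) *
        pw (phase (adaptedAngle (Φ v.1 v.2) (xDep t v) (zDep R t v)))⁻¹ (a v) := by
    intro a v
    have h0 := phase_ne_zero (θ v.1 v.2)
    rw [bobAngle, phase_add, phase_add, phase_ite_four]
    cases a v <;> cases t v <;> cases r v.1 v.2 <;> simp [pw] <;>
      rw [mul_right_comm, inv_mul_cancel₀ h0, one_mul]
  have hamp : recordAmp (fun σ v => angle (bobAngle R Φ θ r σ v)) (fun v => r v.1 v.2)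
      (schedule n m) t ((czGate (R.graph n m)).apply (gridState ψ q)).1 =
      rt ^ (n * (m + 1)) * (∏ i, ∏ j, (q i j).1 false) * adaptedSum R Φ ψ t := by
    rw [recordAmp, adaptedSum, Finset.mul_sum]
    refine Finset.sum_congr rfl fun a _ => ?_
    rw [hlist, czGate_apply, gridState_apply_of_isPlus ψ q θ hθ hq,
      ← Finset.prod_congr rfl fun v _ => hvertex a v]
    simp only [hadamard_mul_rotZ_apply, Finset.prod_mul_distrib, Finset.prod_const,
      Finset.card_univ, Fintype.card_prod, Fintype.card_fin]
    ring
  have hqn : ‖∏ i, ∏ j, (q i j).1 false‖ ^ 2 = (1 / 2) ^ (n * m) := by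
    simp only [norm_prod, ← Finset.prod_pow, norm_sq_of_isPlus (norm_phase _) (hq _ _),
      Finset.prod_const, Finset.card_univ, Fintype.card_fin, ← pow_mul, mul_comm]
  rw [hamp, encodedUnitary_apply, norm_mul, norm_mul, norm_mul, norm_adaptedSum, mul_pow, mul_pow,
    mul_pow, hqn]
  ring

/-- The outcomes outside the last column are free. -/
theorem sum_last_column {n m : ℕ} (h : Bits n → ENNReal) :
    ∑ t : Vertex n m → Bool, h (fun i => t (i, Fin.last m)) = 2 ^ (n * m) * ∑ b, h b := by
  let e : (Bits n × (Fin m → Bits n)) ≃ (Vertex n m → Bool) :=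
    (Fin.snocEquiv fun _ => Bits n).trans
    { toFun := fun p v => p v.2 v.1
      invFun := fun a j i => a (i, j)
      left_inv := fun _ => rfl
      right_inv := fun _ => rfl }
  have he : ∀ p i, e p (i, Fin.last m) = p.1 i := fun p i =>
    congrFun (Fin.snoc_last (α := fun _ => Bits n) p.1 p.2) i
  rw [← Equiv.sum_comp e, Fintype.sum_prod_type]
  simp only [he, Finset.sum_const, Finset.card_univ, Fintype.card_fun, Fintype.card_bool,
    Fintype.card_fin, nsmul_eq_mul, ← Finset.mul_sum, ← pow_mul]
  push_cast
  rfl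

/-- With correctly prepared qubits, the decoded outcomes of the last column are distributed like the
output of the circuit. -/
theorem expect_measurements (R : Resource) {n m : ℕ} (Φ θ : Fin n → Fin (m + 1) → ZMod 8)
    (r : Fin n → Fin (m + 1) → Bool) (ψ : QState (Bits n)) (q : Fin n → Fin m → QState Bool)
    (hθ : ∀ i, θ i 0 = 0) (hq : ∀ i j, IsPlus (phase (θ i j.succ)) (q i j))
    (f : Bits n → ENNReal) :
    expect ((schedule n m).foldlM
        (adaptiveStep (fun σ v => angle (bobAngle R Φ θ r σ v)) fun v => r v.1 v.2)
        ((czGate (R.graph n m)).apply (gridState ψ q), fun _ => false))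
        (fun st => f fun i => st.2 (i, Fin.last m)) =
      expect (idealOutput R Φ ψ) f := by
  have hdep : ∀ (σ τ : Vertex n m → Bool) (v : Vertex n m),
      (∀ u : Vertex n m, u.2.val < v.2.val → σ u = τ u) →
      angle (bobAngle R Φ θ r σ v) = angle (bobAngle R Φ θ r τ v) := by
    intro σ τ v h
    rw [bobAngle, bobAngle, xDep_congr h, zDep_congr R h]
  have hpow : (2 : ENNReal) ^ (n * m) * ENNReal.ofReal ((1 / 2) ^ (n * m)) = 1 := by
    rw [ENNReal.ofReal_pow (by norm_num), ← mul_pow, one_div,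
      ENNReal.ofReal_inv_of_pos (by norm_num), ENNReal.ofReal_ofNat,
      ENNReal.mul_inv_cancel (by norm_num) (by norm_num), one_pow]
  rw [expect_foldlM_adaptiveStep_of_forall_mem (fun σ v => angle (bobAngle R Φ θ r σ v))
    (fun v => r v.1 v.2) (fun v => v.2.val) hdep (fun t => f fun i => t (i, Fin.last m)) _
    (schedule_nodup n m) (schedule_sorted n m) mem_schedule]
  have hterm : ∀ t : Vertex n m → Bool,
      ENNReal.ofReal (‖recordAmp (fun σ v => angle (bobAngle R Φ θ r σ v)) (fun v => r v.1 v.2)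
        (schedule n m) t ((czGate (R.graph n m)).apply (gridState ψ q)).1‖ ^ 2) *
        f (fun i => t (i, Fin.last m)) =
      ENNReal.ofReal ((1 / 2) ^ (n * m)) * (fun b => ENNReal.ofReal
        (‖((encodedUnitary R Φ).apply ψ).1 b‖ ^ 2) * f b) fun i => t (i, Fin.last m) := by
    intro t
    rw [norm_sq_recordAmp R Φ θ r ψ q hθ hq, ENNReal.ofReal_mul (by positivity), mul_assoc]
  have hborn : ∀ b, idealOutput R Φ ψ b =
      ENNReal.ofReal (‖((encodedUnitary R Φ).apply ψ).1 b‖ ^ 2) := fun _ => rfl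
  refine (Finset.sum_congr rfl fun t _ => hterm t).trans ?_
  rw [← Finset.mul_sum, sum_last_column fun b =>
      ENNReal.ofReal (‖((encodedUnitary R Φ).apply ψ).1 b‖ ^ 2) * f b, ← mul_assoc, mul_comm (ENNReal.ofReal _), hpow, one_mul,
    expect_fintype]
  simp only [hborn]

/-! ### The honest run -/

theorem expect_le_of_forall_le {α : Type} (p : PMF α) {g : α → ENNReal} {c : ENNReal}
    (h : ∀ a, g a ≤ c) : expect p g ≤ c :=
  (expect_mono p fun a _ => h a).trans (expect_const p c).le

/-- As `Π'` is perfectly complete, a measurement round is a step of an adaptive measurement. -/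
theorem measurementRound_eq (P : Primitives lam) (hA : P.zkAngle.Complete P.RelAngle 0)
    (R : Resource) {n m : ℕ} (Φ : Fin n → Fin (m + 1) → ZMod 8) (r : Fin n → Fin (m + 1) → Bool)
    (θ : Fin n → Fin (m + 1) → ZMod 8) (cφ : Fin n → Fin (m + 1) → P.com.Com × P.com.Dec)
    (hc : ∀ i j, P.com.verify (cφ i j).1 (cφ i j).2 (encodeAngle (Φ i j)) = true) :
    measurementRound P R Φ r θ cφ = fun st v => liftM
      (adaptiveStep (fun σ v => angle (bobAngle R Φ θ r σ v)) (fun v => r v.1 v.2) st v) := by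
  funext st v
  have hrun : P.zkAngle.run (bobAngle R Φ θ r st.2 v, zDep R st.2 v, xDep st.2 v,
      (cφ v.1 v.2).1) (r v.1 v.2, θ v.1 v.2, adaptedAngle (Φ v.1 v.2) (xDep st.2 v)
        (zDep R st.2 v), (cφ v.1 v.2).2) = pure true := by
    refine eq_pure_true_of_complete _ ?_
    have h := hA (bobAngle R Φ θ r st.2 v, zDep R st.2 v, xDep st.2 v,
      (cφ v.1 v.2).1) (r v.1 v.2, θ v.1 v.2, adaptedAngle (Φ v.1 v.2) (xDep st.2 v)
        (zDep R st.2 v), (cφ v.1 v.2).2) ⟨rfl, Φ v.1 v.2, rfl, hc _ _⟩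
    rwa [sub_zero] at h
  refine OptionT.ext ?_
  have hround : measurementRound P R Φ r θ cφ st v =
      (liftM (P.zkAngle.run (bobAngle R Φ θ r st.2 v, zDep R st.2 v, xDep st.2 v,
        (cφ v.1 v.2).1) (r v.1 v.2, θ v.1 v.2, adaptedAngle (Φ v.1 v.2) (xDep st.2 v)
        (zDep R st.2 v), (cφ v.1 v.2).2)) : OptionT PMF Bool) >>= fun ok =>
      continueIf ok >>= fun _ =>
      (liftM (measureXY v (angle (bobAngle R Φ θ r st.2 v)) st.1) : OptionT PMF _) >>= fun out =>
      pure (out.2, Function.update st.2 v (xor out.1 (r v.1 v.2))) := rfl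
  rw [hround, hrun, run_lift_bind, pure_bind, continueIf, if_pos rfl, pure_bind, run_lift_bind,
    run_lift]
  change _ = PMF.map some (PMF.bind _ _)
  rw [PMF.map_bind]
  refine congrArg (PMF.bind _) (funext fun out => ?_)
  exact (PMF.pure_map some _).symm

theorem run_foldlM_lift {α β : Type} (f : β → α → PMF β) (L : List α) (b : β) :
    (L.foldlM (fun b a => (liftM (f b a) : OptionT PMF β)) b).run = (L.foldlM f b).map some := by
  induction L generalizing b with
  | nil => exact (PMF.pure_map some b).symm
  | cons a L ih =>
    rw [List.foldlM_cons, run_lift_bind, List.foldlM_cons]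
    simp only [ih]
    exact (PMF.map_bind _ _ _).symm

/-- Once all qubits are prepared correctly and the angle commitments open, the protocol does not
abort any more and its output is ideal. -/
theorem expect_measurement_phase (P : Primitives lam) (hA : P.zkAngle.Complete P.RelAngle 0)
    (R : Resource) {n m : ℕ} (Φ : Fin n → Fin (m + 1) → ZMod 8) (r : Fin n → Fin (m + 1) → Bool)
    (cφ : Fin n → Fin (m + 1) → P.com.Com × P.com.Dec)
    (hc : ∀ i j, P.com.verify (cφ i j).1 (cφ i j).2 (encodeAngle (Φ i j)) = true)
    (ψ : QState (Bits n)) (prep : Fin n → Fin m → ZMod 8 × QState Bool)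
    (hprep : ∀ i j, IsPlus (phase (prep i j).1) (prep i j).2) (h : Option (Bits n) → ENNReal) :
    expect ((schedule n m).foldlM
        (measurementRound P R Φ r (fun i => Fin.cons 0 fun j => (prep i j).1) cφ)
        ((czGate (R.graph n m)).apply (gridState ψ fun i j => (prep i j).2), fun _ => false) >>=
        fun final => (pure fun i => final.2 (i, Fin.last m) : OptionT PMF (Bits n))).run h =
      expect (idealOutput R Φ ψ) fun b => h (some b) := by
  rw [← expect_measurements R Φ (fun i => Fin.cons 0 fun j => (prep i j).1) r ψ
    (fun i j => (prep i j).2) (fun i => rfl) hprep fun b => h (some b), expect_run_bind,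
    measurementRound_eq P hA R Φ r _ cφ hc, run_foldlM_lift, expect_map]
  congr 1
  funext st
  exact expect_pure _ _

theorem expect_uniform_bxor {k : ℕ} (a : Bits k) (g : Bits k → ENNReal) :
    expect (PMF.uniformOfFintype (Bits k)) (fun x => g (bxor a x)) =
      expect (PMF.uniformOfFintype (Bits k)) g := by
  let e : Bits k ≃ Bits k := Function.Involutive.toPerm (bxor a) fun x => by
    funext i
    simp [bxor]
  simp only [expect_fintype, PMF.uniformOfFintype_apply, ← Finset.mul_sum]
  rw [← Equiv.sum_comp e g]
  rfl

/-- Alice's coins are masked by Bob's, so each key is generated from uniform coins. -/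
theorem expect_badProb_coins_le {F : TrapdoorFamily lam} {ε : ℝ} (h : F.TwoRegular ε) {n k : ℕ}
    (a : Bits lam) (i : Fin n) (j : Fin k) :
    expect (PMF.uniformOfFintype (Fin n → Fin k → Bits lam))
      (fun rB => F.badProb (bxor a (rB i j))) ≤ ENNReal.ofReal ε := by
  rw [expect_uniform_eval i fun x : Fin k → Bits lam => F.badProb (bxor a (x j)),
    expect_uniform_eval j fun x => F.badProb (bxor a x), expect_uniform_bxor]
  exact expect_badProb_le h

theorem failProb_commit_grid (C : CommitmentScheme) {n k : ℕ} (msg : Fin n → Fin k → List Bool) :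
    failProb (forGrid fun i j => (liftM (C.commit (msg i j)) : OptionT PMF (C.Com × C.Dec))).run
      (some '' {c | ∀ i j, C.verify (c i j).1 (c i j).2 (msg i j) = true}) ≤ 0 := by
  have h := failProb_forGrid_le
    (fun i j => (liftM (C.commit (msg i j)) : OptionT PMF (C.Com × C.Dec)))
    (fun i j => {c | C.verify c.1 c.2 (msg i j) = true}) (fun _ _ => 0) fun i j => by
      rw [failProb_lift]
      exact (failProb_eq_zero _ _ fun c hc => C.correct _ c hc).le
  simp only [Finset.sum_const_zero] at h
  exact h

theorem failProb_check_grid {n m : ℕ} (p : Fin n → Fin (m + 1) → PMF Bool) (ε : ℝ)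
    (hp : ∀ i j, 1 - ε ≤ (p i j true).toReal) :
    failProb (forGrid fun i j => (do
        let ok ← (liftM (p i j) : OptionT PMF Bool)
        continueIf ok : OptionT PMF Unit)).run (some '' {a | ∀ i j, a i j ∈ Set.univ}) ≤
      n * ((m + 1) * ENNReal.ofReal ε) := by
  have h := failProb_forGrid_le _ (fun _ _ => Set.univ) _ fun i j => failProb_check_le _ (hp i j)
  simpa using h

/-- Every test accepts the output of the honest run with at most the ideal probability plus the
errors of the primitives. -/
theorem expect_honestRun_le (P : Primitives lam) {εF εOpen εKey : ℝ}
    (hP : P.Correct εF εOpen εKey) (R : Resource) {n m : ℕ} (Φ : Fin n → Fin (m + 1) → ZMod 8)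
    (ψ : QState (Bits n)) (h : Option (Bits n) → ENNReal) (h1 : ∀ o, h o ≤ 1) :
    expect (honestRun P R Φ ψ) h ≤ expect ((idealOutput R Φ ψ).map some) h +
      n * ((m + 1) *
        (2 * ENNReal.ofReal εF + ENNReal.ofReal εOpen + ENNReal.ofReal εKey)) := by
  rw [expect_map, honestRun]
  set c := expect (idealOutput R Φ ψ) (h ∘ some)
  rw [run_lift_bind, expect_bind]
  refine expect_le_of_forall_le _ fun rA => ?_
  rw [run_lift_bind, expect_bind]
  refine expect_le_of_forall_le _ fun r => ?_
  rw [← add_zero (c + _)]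
  refine expect_run_bind_le _ _ _ h1
    (failProb_commit_grid P.com fun i j => List.ofFn (rA i j)) fun cf hcf => ?_
  rw [← add_zero (c + _)]
  refine expect_run_bind_le _ _ _ h1
    (failProb_commit_grid P.com fun i j => encodeAngle (Φ i j)) fun cφ hcφ => ?_
  have hsplit : c + n * ((m + 1) *
      (2 * ENNReal.ofReal εF + ENNReal.ofReal εOpen + ENNReal.ofReal εKey)) =
      c + n * ((m + 1) * (2 * ENNReal.ofReal εF)) + n * ((m + 1) * ENNReal.ofReal εKey) +
        n * ((m + 1) * ENNReal.ofReal εOpen) := by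
    ring
  rw [hsplit]
  refine expect_run_bind_le _ _ _ h1
    (failProb_check_grid _ _ fun i j => hP.openComplete _ _ (hcφ i j)) fun _ _ => ?_
  rw [run_lift_bind, expect_bind]
  -- the failure probability of the preparation depends on the joint coins, and is averaged over
  -- Bob's share
  refine (expect_mono (g := fun rB : Fin n → Fin (m + 1) → Bits lam =>
    c + (∑ i : Fin n, ∑ j : Fin m, 2 * P.tdf.badProb (bxor (rA i j.succ) (rB i j.succ))) +
      n * ((m + 1) * ENNReal.ofReal εKey)) _ fun rB _ => ?_).trans ?_
  · refine expect_run_bind_le _ _ _ h1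
      (failProb_check_grid _ _ fun i j => hP.keyComplete _ _ ⟨hcf i j, rfl⟩) fun _ _ => ?_
    refine expect_run_bind_le _ _ _ h1 (failProb_forGrid_le _
      (fun _ _ => {out | IsPlus (phase out.1) out.2}) _ fun i j => ?_) fun prep hprep => ?_
    · rw [failProb_lift]
      exact failProb_qfactory8_le _ _
    · exact (expect_measurement_phase P hP.angleComplete R Φ r cφ hcφ ψ prep hprep h).le
  rw [expect_add, expect_add, expect_const, expect_const]
  gcongr
  rw [expect_sum]
  calc ∑ i : Fin n, expect (PMF.uniformOfFintype (Fin n → Fin (m + 1) → Bits lam))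
        (fun rB => ∑ j : Fin m, 2 * P.tdf.badProb (bxor (rA i j.succ) (rB i j.succ)))
      ≤ ∑ _i : Fin n, ∑ _j : Fin m, 2 * ENNReal.ofReal εF := by
        refine Finset.sum_le_sum fun i _ => ?_
        rw [expect_sum]
        refine Finset.sum_le_sum fun j _ => ?_
        simp only [two_mul, expect_add]
        exact add_le_add (expect_badProb_coins_le hP.twoRegular _ _ _)
          (expect_badProb_coins_le hP.twoRegular _ _ _)
    _ = n * (m * (2 * ENNReal.ofReal εF)) := by simp
    _ ≤ n * ((m + 1) * (2 * ENNReal.ofReal εF)) := by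
        gcongr
        exact le_self_add

/-! ### The bounds on the distance -/

theorem InteractiveArgument.Complete.nonneg {X W : Type} {A : InteractiveArgument X W}
    {Rel : X → W → Prop} {ε : ℝ} (hA : A.Complete Rel ε) {x : X} {w : W} (hxw : Rel x w) :
    0 ≤ ε := by
  have h1 := hA x w hxw
  have h2 : (A.run x w true).toReal ≤ 1 := by
    rw [← ENNReal.toReal_one]
    exact ENNReal.toReal_mono ENNReal.one_ne_top ((A.run x w).coe_le_one true)
  linarith

/-- The errors are nonnegative: the relations proved in the protocol are inhabited, and no
acceptance probability exceeds one. -/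
theorem Primitives.Correct.nonneg {P : Primitives lam} {εF εOpen εKey : ℝ}
    (hP : P.Correct εF εOpen εKey) : 0 ≤ εF ∧ 0 ≤ εOpen ∧ 0 ≤ εKey := by
  refine ⟨?_, ?_, ?_⟩
  · have h := (Nat.cast_nonneg _).trans hP.twoRegular
    exact nonneg_of_mul_nonneg_left h (by exact_mod_cast Fintype.card_pos)
  · obtain ⟨p, hp⟩ := (P.com.commit []).support_nonempty
    exact hP.openComplete.nonneg (x := p.1) (w := (p.2, [])) (P.com.correct _ p hp)
  · let rA : Bits lam := fun _ => false
    obtain ⟨p, hp⟩ := (P.com.commit (List.ofFn rA)).support_nonempty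
    exact hP.keyComplete.nonneg (x := ((P.tdf.gen (bxor rA rA)).1, rA, p.1)) (w := (rA, p.2))
      ⟨P.com.correct _ p hp, rfl⟩

theorem tvDist_honestRun_le (P : Primitives lam) {εF εOpen εKey : ℝ}
    (hP : P.Correct εF εOpen εKey) (R : Resource) {n m : ℕ} (Φ : Fin n → Fin (m + 1) → ZMod 8)
    (ψ : QState (Bits n)) :
    tvDist (honestRun P R Φ ψ) ((idealOutput R Φ ψ).map some) ≤
      n * (m + 1) * (2 * εF + εOpen + εKey) := by
  obtain ⟨hF, hO, hK⟩ := hP.nonneg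
  refine tvDist_le_of_expect_le _ _ (by positivity) fun g hg => ?_
  refine (expect_honestRun_le P hP R Φ ψ g hg).trans_eq ?_
  congr 1
  rw [mul_assoc, ENNReal.ofReal_mul (by positivity), ENNReal.ofReal_mul (by positivity),
    ENNReal.ofReal_add (by positivity) hK, ENNReal.ofReal_add (by positivity) hO,
    ENNReal.ofReal_mul (by norm_num), ENNReal.ofReal_add (by positivity) (by norm_num)]
  simp

theorem negligible_of_le_poly {ε d : ℕ → ℝ} (hε : Negligible ε) (hε0 : ∀ k, 0 ≤ ε k)
    {n m : ℕ → ℕ} (hn : PolyBounded n) (hm : PolyBounded m) (hd0 : ∀ k, 0 ≤ d k)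
    (hd : ∀ k, d k ≤ n k * (m k + 1) * ε k) : Negligible d := by
  obtain ⟨p, hp⟩ := hn
  obtain ⟨q, hq⟩ := hm
  have h := Asymptotics.SuperpolynomialDecay.mul_polynomial hε
    ((p * (q + 1)).map (Nat.castRingHom ℝ))
  refine h.trans_abs_le fun k => ?_
  rw [abs_of_nonneg (hd0 k)]
  refine le_trans ?_ (le_abs_self _)
  refine (hd k).trans ?_
  have he : Polynomial.eval (k : ℝ) ((p * (q + 1)).map (Nat.castRingHom ℝ)) =
      ((p.eval k * (q.eval k + 1) : ℕ) : ℝ) := by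
    rw [Polynomial.eval_natCast_map]
    simp
  rw [he, mul_comm (ε k)]
  push_cast
  have h1 : (n k : ℝ) ≤ (p.eval k : ℕ) := by exact_mod_cast hp k
  have h2 : (m k : ℝ) ≤ (q.eval k : ℕ) := by exact_mod_cast hq k
  have := hε0 k
  gcongr

end Q2PC

end

theorem mainTheorem9 (P : ∀ lam : ℕ, Q2PC.Primitives lam) (εF εOpen εKey : ℕ → ℝ)
    (hP : ∀ lam, (P lam).Correct (εF lam) (εOpen lam) (εKey lam)) :
    (∀ (lam n m : ℕ) (R : Q2PC.Resource) (Φ : Fin n → Fin (m + 1) → ZMod 8)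
        (ψ : Q2PC.QState (Q2PC.Bits n)),
      Q2PC.tvDist (Q2PC.honestRun (P lam) R Φ ψ) ((Q2PC.idealOutput R Φ ψ).map some) ≤
        n * (m + 1) * (2 * εF lam + εOpen lam + εKey lam)) ∧
    (∀ lam : ℕ, εF lam = 0 → εOpen lam = 0 → εKey lam = 0 →
      ∀ (n m : ℕ) (R : Q2PC.Resource) (Φ : Fin n → Fin (m + 1) → ZMod 8)
        (ψ : Q2PC.QState (Q2PC.Bits n)),
      Q2PC.honestRun (P lam) R Φ ψ = (Q2PC.idealOutput R Φ ψ).map some) ∧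
    (Q2PC.Negligible εF → Q2PC.Negligible εOpen → Q2PC.Negligible εKey →
      ∀ (n m : ℕ → ℕ), Q2PC.PolyBounded n → Q2PC.PolyBounded m →
      ∀ (R : ℕ → Q2PC.Resource) (Φ : ∀ lam, Fin (n lam) → Fin (m lam + 1) → ZMod 8)
        (ψ : ∀ lam, Q2PC.QState (Q2PC.Bits (n lam))),
      Q2PC.Negligible fun lam =>
        Q2PC.tvDist (Q2PC.honestRun (P lam) (R lam) (Φ lam) (ψ lam))
          ((Q2PC.idealOutput (R lam) (Φ lam) (ψ lam)).map some)) := by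
  refine ⟨fun lam n m R Φ ψ => Q2PC.tvDist_honestRun_le (P lam) (hP lam) R Φ ψ, ?_, ?_⟩
  · intro lam hF hO hK n m R Φ ψ
    refine Q2PC.eq_of_tvDist_le_zero ?_
    have h := Q2PC.tvDist_honestRun_le (P lam) (hP lam) R Φ ψ
    rw [hF, hO, hK] at h
    simpa using h
  · intro hF hO hK n m hn hm R Φ ψ
    have hsum : Q2PC.Negligible fun lam => 2 * εF lam + εOpen lam + εKey lam :=
      ((hF.const_mul 2).add hO).add hK
    refine Q2PC.negligible_of_le_poly hsum (fun lam => ?_) hn hm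
      (fun lam => Q2PC.tvDist_nonneg _ _)
      fun lam => Q2PC.tvDist_honestRun_le (P lam) (hP lam) (R lam) (Φ lam) (ψ lam)
    obtain ⟨h1, h2, h3⟩ := (hP lam).nonneg
    positivity
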